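/- Work in first-order logic with equality in the language $\{\in\}$ of set theory. $\Delta_0$ is the smallest class of formulas that contains the atomic formulas and is closed under connectives and under the quantifiers $\forall x\in y$, $\exists x\in y$ ($x,y$ distinct variables); $\Delta_0^{\mathcal P}$ is the smallest such class that is moreover closed under the quantifiers $\forall x\subseteq y$, $\exists x\subseteq y$. Starting from $\Sigma_0=\Pi_0=\Delta_0$, a $\Sigma_{n+1}$-formula (respectively $\Pi_{n+1}$-formula) is a possibly empty block of existential (respectively universal) quantifiers followed by a $\Pi_n$-formula (respectively $\Sigma_n$-formula); $\Sigma_n^{\mathcal P}$ and $\Pi_n^{\mathcal P}$ are obtained in the same way from $\Delta_0^{\mathcal P}$. For a class $\Gamma$ of formulas, $\Gamma$-separation is the scheme $$\forall\vec z\,\forall w\,\exists y\,\forall x\,(x\in y\Leftrightarrow x\in w\wedge\phi(x,\vec z)),\qquad \phi\in\Gamma,$$ and $\Gamma$-collection is the scheme $$\forall\vec z\,\forall w\,\bigl((\forall x\in w)\exists y\,\phi(x,y,\vec z)\Rightarrow\exists C(\forall x\in w)(\exists y\in C)\phi(x,y,\vec z)\bigr),\qquad \phi\in\Gamma.$$ Let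 $\mathbf M$ be the theory with the axioms extensionality, emptyset, pair, union, set difference, powerset, transitive containment $\forall x\exists y(\bigcup y\subseteq y\wedge x\subseteq y)$, infinity, $\Delta_0$-separation, and set foundation (every nonempty set has an $\in$-minimal element). Axiom $\mathrm H$ is $$\forall u\,\exists T\bigl(\textstyle\bigcup T\subseteq T\wedge\forall z(\bigcup z\subseteq z\wedge|z|\le|u|\Rightarrow z\subseteq T)\bigr),$$ where $|z|\le|u|$ means that there is an injection from $z$ into $u$. Let $\mathrm{Mac}$ be $\mathbf M$ plus the axiom of choice, and let $\mathrm{MOST}$ be $\mathrm{Mac}$ plus $\Sigma_1$-separation plus $\Delta_0$-collection. A theory $S$ is $\Gamma$-conservative over a theory $T$ if $S$ and $T$ prove the same sentences in $\Gamma$. Theorem. (I) The theory $\mathbf M+\mathrm H+\Delta_0^{\mathcal P}\text{-collection}$ is $\Pi_2^{\mathcal P}$-conservative over the theory $\mathbf M+\mathrm H$. (II) The theory $\mathrm{MOST}+\Pi_1\text{-collection}$ is $\Pi_3$-conservative over the theory $\mathrm{MOST}$. -/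

import Mathlib

namespace WeakSetTheory

open FirstOrder FirstOrder.Language

/-! ### The language of set theory -/

/-- The relation symbols of the language of set theory: one binary symbol, membership. -/
inductive MemRel : ℕ → Type
  | mem : MemRel 2

/-- The first-order language of set theory. Its only terms are variables. -/
def LSet : FirstOrder.Language.{0, 0} := ⟨fun _ => Empty, MemRel⟩

/-! ### Provability in first-order logic with equality

Derivations are in natural deduction for formulas whose free variables are indexed by `ℕ`. -/

section Provability

variable {L : FirstOrder.Language.{0, 0}}

/-- The formula `φ(t)`, for `φ` with one distinguished variable. -/
def inst (φ : L.BoundedFormula ℕ 1) (t : L.Term ℕ) : L.Formula ℕ :=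
  φ.toFormula.subst (Sum.elim Term.var fun _ => t)

/-- A sentence, regarded as a formula with free variables among those indexed by `ℕ`. -/
def liftSentence (σ : L.Sentence) : L.Formula ℕ :=
  Formula.relabel Empty.elim σ

/-- `Derivable T Γ φ`: there is a natural deduction of `φ` from axioms in `T` and open
assumptions in the list `Γ`. -/
inductive Derivable (T : L.Theory) : List (L.Formula ℕ) → L.Formula ℕ → Prop
  | axm {Γ : List (L.Formula ℕ)} {σ : L.Sentence} (h : σ ∈ T) : Derivable T Γ (liftSentence σ)
  | hyp {Γ : List (L.Formula ℕ)} {φ : L.Formula ℕ} (h : φ ∈ Γ) : Derivable T Γ φ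
  | imp_intro {Γ : List (L.Formula ℕ)} {φ ψ : L.Formula ℕ} (h : Derivable T (φ :: Γ) ψ) :
      Derivable T Γ (φ ⟹ ψ)
  | imp_elim {Γ : List (L.Formula ℕ)} {φ ψ : L.Formula ℕ} (h₁ : Derivable T Γ (φ ⟹ ψ))
      (h₂ : Derivable T Γ φ) : Derivable T Γ ψ
  | by_contradiction {Γ : List (L.Formula ℕ)} {φ : L.Formula ℕ}
      (h : Derivable T (∼φ :: Γ) ⊥) : Derivable T Γ φ
  | all_intro {Γ : List (L.Formula ℕ)} {φ : L.BoundedFormula ℕ 1} (x : ℕ)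
      (hφ : x ∉ φ.freeVarFinset) (hΓ : ∀ ψ ∈ Γ, x ∉ ψ.freeVarFinset)
      (h : Derivable T Γ (inst φ (Term.var x))) : Derivable T Γ (∀' φ)
  | all_elim {Γ : List (L.Formula ℕ)} {φ : L.BoundedFormula ℕ 1} (t : L.Term ℕ)
      (h : Derivable T Γ (∀' φ)) : Derivable T Γ (inst φ t)
  | eq_refl {Γ : List (L.Formula ℕ)} (t : L.Term ℕ) : Derivable T Γ (t.equal t)
  | eq_subst {Γ : List (L.Formula ℕ)} {s t : L.Term ℕ} (φ : L.BoundedFormula ℕ 1)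
      (h₁ : Derivable T Γ (s.equal t)) (h₂ : Derivable T Γ (inst φ s)) : Derivable T Γ (inst φ t)

/-- `T ⊢ σ`: the theory `T` proves the sentence `σ`. -/
def Proves (T : L.Theory) (σ : L.Sentence) : Prop :=
  Derivable T [] (liftSentence σ)

/-- `S` is `C`-conservative over `T`: the two theories prove the same sentences of class `C`. -/
def ConservativeOver (C : L.Sentence → Prop) (S T : L.Theory) : Prop :=
  ∀ σ : L.Sentence, C σ → (Proves S σ ↔ Proves T σ)

end Provability

/-! ### Basic formulas

Bound variables are de Bruijn levels: `&0` is bound by the outermost quantifier, `&1` by the next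
one, and so on. -/

section BasicFormulas

variable {α : Type} {n : ℕ}

/-- `s ∈ t` -/
def memF (s t : LSet.Term (α ⊕ Fin n)) : LSet.BoundedFormula α n :=
  Relations.boundedFormula₂ (L := LSet) MemRel.mem s t

/-- A term viewed in the scope of one more quantifier. -/
def up (t : LSet.Term (α ⊕ Fin n)) : LSet.Term (α ⊕ Fin (n + 1)) :=
  t.relabel (Sum.map id Fin.castSucc)

/-- The variable bound by the innermost quantifier. -/
def last : LSet.Term (α ⊕ Fin (n + 1)) := Term.var (Sum.inr (Fin.last n))

/-- `(∀ x ∈ t) φ(x)` -/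
def ballMem (t : LSet.Term (α ⊕ Fin n)) (φ : LSet.BoundedFormula α (n + 1)) :
    LSet.BoundedFormula α n := ∀' (memF last (up t) ⟹ φ)

/-- `(∃ x ∈ t) φ(x)` -/
def bexMem (t : LSet.Term (α ⊕ Fin n)) (φ : LSet.BoundedFormula α (n + 1)) :
    LSet.BoundedFormula α n := ∃' (memF last (up t) ⊓ φ)

/-- The free variable with index `a`. -/
def free (a : α) : LSet.Term (α ⊕ Fin n) := Term.var (Sum.inl a)

/-- `s ⊆ t` -/
def subF (s t : LSet.Term (α ⊕ Fin n)) : LSet.BoundedFormula α n :=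
  ballMem s (memF last (up t))

/-- `(∀ x ⊆ t) φ(x)` -/
def ballSub (t : LSet.Term (α ⊕ Fin n)) (φ : LSet.BoundedFormula α (n + 1)) :
    LSet.BoundedFormula α n := ∀' (subF last (up t) ⟹ φ)

/-- `(∃ x ⊆ t) φ(x)` -/
def bexSub (t : LSet.Term (α ⊕ Fin n)) (φ : LSet.BoundedFormula α (n + 1)) :
    LSet.BoundedFormula α n := ∃' (subF last (up t) ⊓ φ)

/-- `t` is transitive: `(∀ y ∈ t)(∀ z ∈ y) z ∈ t`. -/
def transF (t : LSet.Term (α ⊕ Fin n)) : LSet.BoundedFormula α n :=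
  ballMem t (ballMem last (memF last (up (up t))))

/-- `p = {a, b}` -/
def upairF (p a b : LSet.Term (α ⊕ Fin n)) : LSet.BoundedFormula α n :=
  ∀' (memF last (up p) ⇔ (last =' up a ⊔ last =' up b))

/-- `p = ⟨a, b⟩ = {{a}, {a, b}}` -/
def opairF (p a b : LSet.Term (α ⊕ Fin n)) : LSet.BoundedFormula α n :=
  ∀' (memF last (up p) ⇔ (upairF last (up a) (up a) ⊔ upairF last (up a) (up b)))

/-- `⟨a, b⟩ ∈ f` -/
def opairMemF (a b f : LSet.Term (α ⊕ Fin n)) : LSet.BoundedFormula α n :=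
  bexMem f (opairF last (up a) (up b))

end BasicFormulas

/-! ### Classes of formulas -/

/-- A class of formulas of the language of set theory. -/
abbrev FormulaClass := ∀ (α : Type) (n : ℕ), LSet.BoundedFormula α n → Prop

/-- `Δ₀`: the smallest class that contains the atomic formulas and is closed under connectives
and under quantifiers bounded by membership. -/
inductive Delta0 (α : Type) : ∀ n : ℕ, LSet.BoundedFormula α n → Prop
  | atomic {n : ℕ} {φ : LSet.BoundedFormula α n} (h : φ.IsAtomic) : Delta0 α n φ
  | falsum {n : ℕ} : Delta0 α n ⊥
  | imp {n : ℕ} {φ ψ : LSet.BoundedFormula α n} (h₁ : Delta0 α n φ) (h₂ : Delta0 α n ψ) :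
      Delta0 α n (φ ⟹ ψ)
  | ballMem {n : ℕ} (t : LSet.Term (α ⊕ Fin n)) {φ : LSet.BoundedFormula α (n + 1)}
      (h : Delta0 α (n + 1) φ) : Delta0 α n (ballMem t φ)
  | bexMem {n : ℕ} (t : LSet.Term (α ⊕ Fin n)) {φ : LSet.BoundedFormula α (n + 1)}
      (h : Delta0 α (n + 1) φ) : Delta0 α n (bexMem t φ)

/-- `Δ₀^𝒫`: the smallest class that contains the atomic formulas and is closed under connectives
and under quantifiers bounded by membership or by inclusion. -/
inductive Delta0P (α : Type) : ∀ n : ℕ, LSet.BoundedFormula α n → Prop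
  | atomic {n : ℕ} {φ : LSet.BoundedFormula α n} (h : φ.IsAtomic) : Delta0P α n φ
  | falsum {n : ℕ} : Delta0P α n ⊥
  | imp {n : ℕ} {φ ψ : LSet.BoundedFormula α n} (h₁ : Delta0P α n φ) (h₂ : Delta0P α n ψ) :
      Delta0P α n (φ ⟹ ψ)
  | ballMem {n : ℕ} (t : LSet.Term (α ⊕ Fin n)) {φ : LSet.BoundedFormula α (n + 1)}
      (h : Delta0P α (n + 1) φ) : Delta0P α n (ballMem t φ)
  | bexMem {n : ℕ} (t : LSet.Term (α ⊕ Fin n)) {φ : LSet.BoundedFormula α (n + 1)}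
      (h : Delta0P α (n + 1) φ) : Delta0P α n (bexMem t φ)
  | ballSub {n : ℕ} (t : LSet.Term (α ⊕ Fin n)) {φ : LSet.BoundedFormula α (n + 1)}
      (h : Delta0P α (n + 1) φ) : Delta0P α n (ballSub t φ)
  | bexSub {n : ℕ} (t : LSet.Term (α ⊕ Fin n)) {φ : LSet.BoundedFormula α (n + 1)}
      (h : Delta0P α (n + 1) φ) : Delta0P α n (bexSub t φ)

/-- The formulas `∃ x₁ … ∃ xₘ φ`, `m ≥ 0`, with `φ` in the class `C`. -/
inductive ExBlock (C : FormulaClass) (α : Type) : ∀ n : ℕ, LSet.BoundedFormula α n → Prop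
  | base {n : ℕ} {φ : LSet.BoundedFormula α n} (h : C α n φ) : ExBlock C α n φ
  | ex {n : ℕ} {φ : LSet.BoundedFormula α (n + 1)} (h : ExBlock C α (n + 1) φ) :
      ExBlock C α n (∃' φ)

/-- The formulas `∀ x₁ … ∀ xₘ φ`, `m ≥ 0`, with `φ` in the class `C`. -/
inductive AllBlock (C : FormulaClass) (α : Type) : ∀ n : ℕ, LSet.BoundedFormula α n → Prop
  | base {n : ℕ} {φ : LSet.BoundedFormula α n} (h : C α n φ) : AllBlock C α n φ
  | all {n : ℕ} {φ : LSet.BoundedFormula α (n + 1)} (h : AllBlock C α (n + 1) φ) :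
      AllBlock C α n (∀' φ)

mutual

/-- The class `Σₘ` of the hierarchy over the base class `C` (`C = Σ₀ = Π₀`). -/
def SigmaOver (C : FormulaClass) : ℕ → FormulaClass
  | 0 => C
  | m + 1 => ExBlock (PiOver C m)

/-- The class `Πₘ` of the hierarchy over the base class `C` (`C = Σ₀ = Π₀`). -/
def PiOver (C : FormulaClass) : ℕ → FormulaClass
  | 0 => C
  | m + 1 => AllBlock (SigmaOver C m)

end

/-- The Lévy class `Σₘ`. -/
def LevySigma (m : ℕ) : FormulaClass := SigmaOver Delta0 m

/-- The Lévy class `Πₘ`. -/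
def LevyPi (m : ℕ) : FormulaClass := PiOver Delta0 m

/-- The Takahashi class `Πₘ^𝒫`. -/
def TakahashiPi (m : ℕ) : FormulaClass := PiOver Delta0P m

/-! ### Axioms -/

/-- The result of replacing every free variable `i` of `φ` by the variable `g i`, where `Sum.inr j`
stands for the bound variable `&j`. -/
def plug {ι α : Type} {m : ℕ} (g : ι → α ⊕ Fin m) (φ : LSet.Formula ι) :
    LSet.BoundedFormula α m :=
  BoundedFormula.relabel g φ

/-- The universal closure of a formula with free variables `z₀, …, zₖ₋₁`. -/
def univClosure {k : ℕ} (φ : LSet.Formula (Fin k)) : LSet.Sentence :=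
  (plug (Sum.inr : Fin k → Empty ⊕ Fin k) φ).alls

/-- `∀x ∀y (∀z (z ∈ x ⇔ z ∈ y) ⇒ x = y)` -/
def extensionality : LSet.Sentence :=
  ∀' ∀' ((∀' (memF (&2) (&0) ⇔ memF (&2) (&1))) ⟹ (&0 =' &1))

/-- `∃x ∀y (y ∉ x)` -/
def emptyset : LSet.Sentence :=
  ∃' ∀' ∼(memF (&1) (&0))

/-- `∀x ∀y ∃z (z = {x, y})` -/
def pairing : LSet.Sentence :=
  ∀' ∀' ∃' upairF (&2) (&0) (&1)

/-- `∀x ∃y ∀z (z ∈ y ⇔ (∃w ∈ x) z ∈ w)` -/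
def union : LSet.Sentence :=
  ∀' ∃' ∀' (memF (&2) (&1) ⇔ bexMem (&0) (memF (&2) (&3)))

/-- `∀x ∀y ∃z ∀u (u ∈ z ⇔ u ∈ x ∧ u ∉ y)` -/
def setDifference : LSet.Sentence :=
  ∀' ∀' ∃' ∀' (memF (&3) (&2) ⇔ (memF (&3) (&0) ⊓ ∼(memF (&3) (&1))))

/-- `∀x ∃y ∀z (z ∈ y ⇔ z ⊆ x)` -/
def powerset : LSet.Sentence :=
  ∀' ∃' ∀' (memF (&2) (&1) ⇔ subF (&2) (&0))

/-- `∀x ∃y (⋃y ⊆ y ∧ x ⊆ y)` -/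
def transitiveContainment : LSet.Sentence :=
  ∀' ∃' (transF (&1) ⊓ subF (&0) (&1))

/-- `∃x ((∃e ∈ x) e = ∅ ∧ (∀y ∈ x)(∃s ∈ x) s = y ∪ {y})` -/
def infinity : LSet.Sentence :=
  ∃' (bexMem (&0) (∀' ∼(memF (&2) (&1))) ⊓
    ballMem (&0) (bexMem (&0) (∀' (memF (&3) (&2) ⇔ (memF (&3) (&1) ⊔ (&3 =' &1))))))

/-- `∀z (∃x x ∈ z ⇒ ∃y (y ∈ z ∧ (∀x ∈ y) x ∉ z))` -/
def setFoundation : LSet.Sentence :=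
  ∀' ((∃' memF (&1) (&0)) ⟹ ∃' (memF (&1) (&0) ⊓ ballMem (&1) ∼(memF (&2) (&0))))

/-- The axiom of choice: for every set `x` of nonempty, pairwise disjoint sets there is a set `c`
that meets each member of `x` in exactly one point. -/
def choice : LSet.Sentence :=
  ∀' ((ballMem (&0) (∃' memF (&2) (&1)) ⊓
      ballMem (&0) (ballMem (&0) ((∃' (memF (&3) (&1) ⊓ memF (&3) (&2))) ⟹ (&1 =' &2)))) ⟹
    ∃' ballMem (&0) (∃' ∀' ((memF (&4) (&2) ⊓ memF (&4) (&1)) ⇔ (&4 =' &3))))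

/-- `f` is an injection from `z` into `u`, that is: every member of `f` is `⟨a, b⟩` for some `a ∈ z`
and `b ∈ u`; for every `a ∈ z` there is `b ∈ u` such that `b` is the unique `c` with `⟨a, c⟩ ∈ f`;
and `⟨a, b⟩, ⟨a', b⟩ ∈ f` implies `a = a'`. Here `f`, `z`, `u` are the free variables `0`, `1`,
`2`. -/
def injectionF : LSet.Formula (Fin 3) :=
  ballMem (free 0) (bexMem (free 1) (bexMem (free 2) (opairF (&0) (&1) (&2)))) ⊓
    (ballMem (free 1) (bexMem (free 2) (∀' (opairMemF (&0) (&2) (free 0) ⇔ (&2 =' &1)))) ⊓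
      ∀' ∀' ∀' ((opairMemF (&0) (&2) (free 0) ⊓ opairMemF (&1) (&2) (free 0)) ⟹ (&0 =' &1)))

/-- Axiom H: `∀u ∃T (⋃T ⊆ T ∧ ∀z (⋃z ⊆ z ∧ |z| ≤ |u| ⇒ z ⊆ T))`, where `|z| ≤ |u|` says that there
is an injection from `z` into `u`. -/
def axiomH : LSet.Sentence :=
  ∀' ∃' (transF (&1) ⊓
    ∀' ((transF (&2) ⊓
        ∃' (plug ![Sum.inr 3, Sum.inr 2, Sum.inr 0] injectionF)) ⟹
      subF (&2) (&1)))

/-- `C`-separation: for all `φ(x, z₀, …, zₖ₋₁)` in `C`,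
`∀z₀ … ∀zₖ₋₁ ∀w ∃y ∀x (x ∈ y ⇔ x ∈ w ∧ φ(x, z₀, …, zₖ₋₁))`.
In `φ` the variable `x` is `Sum.inr 0`. -/
def separation (C : FormulaClass) : LSet.Theory :=
  {σ | ∃ (k : ℕ) (φ : LSet.Formula (Fin k ⊕ Fin 1)), C _ _ φ ∧
    σ = univClosure (∀' ∃' ∀' (memF (&2) (&1) ⇔
      (memF (&2) (&0) ⊓ plug (Sum.map id ![2]) φ)))}

/-- `C`-collection: for all `φ(x, y, z₀, …, zₖ₋₁)` in `C`,
`∀z₀ … ∀zₖ₋₁ ∀w ((∀x ∈ w) ∃y φ(x, y, z₀, …, zₖ₋₁) ⇒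
  ∃c (∀x ∈ w)(∃y ∈ c) φ(x, y, z₀, …, zₖ₋₁))`.
In `φ` the variables `x` and `y` are `Sum.inr 0` and `Sum.inr 1`. -/
def collection (C : FormulaClass) : LSet.Theory :=
  {σ | ∃ (k : ℕ) (φ : LSet.Formula (Fin k ⊕ Fin 2)), C _ _ φ ∧
    σ = univClosure (∀' (
      ballMem (&0) (∃' plug (Sum.map id ![1, 2]) φ) ⟹
      ∃' ballMem (&0) (bexMem (&1) (plug (Sum.map id ![2, 3]) φ))))}

/-! ### Theories -/

/-- The theory `S₁`. -/
def S1 : LSet.Theory :=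
  {extensionality, emptyset, pairing, union, setDifference, powerset}

/-- The theory `M`. -/
def M : LSet.Theory :=
  S1 ∪ {transitiveContainment, infinity, setFoundation} ∪ separation Delta0

/-- The theory `Mac`. -/
def Mac : LSet.Theory := M ∪ {choice}

/-- The theory `M + H`. -/
def MH : LSet.Theory := M ∪ {axiomH}

/-- The theory `MOST`. -/
def MOST : LSet.Theory := Mac ∪ separation (LevySigma 1) ∪ collection Delta0

end WeakSetTheory

-- Only one direction needs an argument: what the stronger theory proves must already follow from
-- the weaker theory `T`. Suppose that `T` does not prove `σ`. By completeness `σ` fails in a model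
-- of `T`, and an ultrapower over `ℕ` gives an elementarily equivalent model `K` that is countably
-- saturated (`exists_countablySaturated`). Since `σ` is a block of universal quantifiers followed
-- by an existential formula, its failure in `K` is witnessed by a finite tuple `a`. In `K` one
-- builds, along the natural numbers of the metatheory, a tower of transitive sets `V 0, V 1, …`
-- such that `V (n + 1)` contains all subsets of `V n` and `a` lies in `V 0`. The new model is the
-- limit of the tower, that is, the class `N` of all elements of the sets `V n`.
--
-- The class `N` is transitive and closed under subsets, so `Δ₀^𝒫` formulas are absolute between `N`
-- and `K`, and the axioms of `M` pass from `K` to `N`. Collection comes from saturation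
-- (`CountablySaturated.exists_bound`). If every `x ∈ w` has a witness in `N`, then one `V n`
-- contains a witness for every `x ∈ w`: otherwise the conditions "`x ∈ w` has no witness in `V n`",
-- which grow stronger with `n`, would have a common solution, and that `x` would have no witness in
-- `N`. The set `V n` is an element of `N`, so it is the set that collection asks for. This works
-- for every class of formulas that is absolute between `N` and `K`. Finally, existential statements
-- with absolute matrix go up from `N` to `K`, so `a` still refutes `σ` in `N`, and soundness ends
-- the proof (`conservative_of_limit`).
--
-- The two parts differ in what the tower has to ensure. For (I), `V (n + 1)` contains a set as in
-- axiom H for `V n`, which gives H in `N`. For (II), `N` is made a `Σ₁`-elementary substructure of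
-- `K` (`IsTower.sigmaOne_iff`): `Σ₁`-separation and `Δ₀`-collection in `K` put witnesses for the
-- elements of a set into a set, and bookkeeping treats all bounded formulas. Then `Σ₁`-separation
-- passes to `N`, and `Π₁` formulas are absolute, which serves both `Π₁`-collection and the matrix
-- of a `Π₃` sentence.

namespace WeakSetTheory

open FirstOrder FirstOrder.Language

-- Substitution, renaming and weakening in the calculus

section Calculus

variable {L : FirstOrder.Language.{0, 0}} {α β γ δ : Type}

/-- Substitution on terms in the scope of bound variables. -/
def bsubst (f : α → L.Term β) (n : ℕ) (t : L.Term (α ⊕ Fin n)) : L.Term (β ⊕ Fin n) :=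
  t.subst (Sum.elim (Term.relabel Sum.inl ∘ f) (Term.var ∘ Sum.inr))

theorem term_subst_relabel (t : L.Term α) (f : α → L.Term β) (g : β → γ) :
    (t.subst f).relabel g = t.subst fun a => (f a).relabel g := by
  induction t with
  | var => rfl
  | func _ _ ih => simp [ih]

theorem term_relabel_subst (t : L.Term α) (g : α → β) (f : β → L.Term γ) :
    (t.relabel g).subst f = t.subst fun a => f (g a) := by
  induction t with
  | var => rfl
  | func _ _ ih => simp [ih]

theorem term_subst_subst (t : L.Term α) (f : α → L.Term β) (g : β → L.Term γ) :
    (t.subst f).subst g = t.subst fun a => (f a).subst g := by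
  induction t with
  | var => rfl
  | func _ _ ih => simp [ih]

theorem term_subst_var (t : L.Term α) : t.subst Term.var = t := by
  induction t with
  | var => rfl
  | func _ _ ih => simp [ih]

/-- Both operations change only the terms at the leaves, so agreement on variables suffices. The
relabelling may turn free variables into bound ones, as happens when `toFormula` passes a
quantifier. -/
theorem relabel_subst_comm {m k : ℕ} (χ : L.BoundedFormula α k) (a : α → L.Term β)
    (h : β → γ ⊕ Fin m) (h' : α → δ ⊕ Fin m) (b : δ → L.Term γ)
    (H : ∀ x, (a x).relabel h = bsubst b m (Term.var (h' x))) :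
    (χ.subst a).relabel h = (χ.relabel h').subst b := by
  have key : ∀ (k : ℕ) (t : L.Term (α ⊕ Fin k)),
      (bsubst a k t).relabel (BoundedFormula.relabelAux h k) =
        bsubst b (m + k) (t.relabel (BoundedFormula.relabelAux h' k)) := by
    intro k t
    simp only [bsubst, term_subst_relabel, term_relabel_subst]
    congr 1
    funext x
    rcases x with x | x
    · have := congrArg (Term.relabel (Sum.map id (Fin.castAdd k))) (H x)
      simp only [bsubst, Term.relabel_relabel, term_subst_relabel] at this
      simp only [Sum.elim_inl, Function.comp_apply, Term.relabel_relabel]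
      have e : (BoundedFormula.relabelAux h k ∘ Sum.inl : β → γ ⊕ Fin (m + k)) =
          Sum.map id (Fin.castAdd k) ∘ h := by
        funext y
        simp only [BoundedFormula.relabelAux, Function.comp_apply, Sum.map_inl]
        rcases h y with z | z <;> simp
      rw [e, this]
      simp only [BoundedFormula.relabelAux, Function.comp_apply, Sum.map_inl, Term.subst]
      rcases h' x with z | z <;> simp [Function.comp_def]
    · simp [BoundedFormula.relabelAux]
  induction χ with
  | falsum => rfl
  | equal t₁ t₂ => exact congrArg₂ BoundedFormula.equal (key _ t₁) (key _ t₂)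
  | rel R ts => exact congrArg (BoundedFormula.rel R) (funext fun i => key _ (ts i))
  | imp _ _ ih₁ ih₂ => exact congrArg₂ BoundedFormula.imp ih₁ ih₂
  | all φ ih =>
    change ((φ.subst a).all).relabel h = (φ.all.relabel h').subst b
    rw [BoundedFormula.relabel_all, BoundedFormula.relabel_all]
    exact congrArg BoundedFormula.all ih

theorem subst_equal (s t : L.Term α) (f : α → L.Term β) :
    (s.equal t : L.Formula α).subst f = (s.subst f).equal (t.subst f) := by
  simp only [Term.equal, Term.bdEqual, BoundedFormula.subst, BoundedFormula.mapTermRel,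
    term_relabel_subst, term_subst_relabel]
  rfl

theorem subst_formula {n : ℕ} (R : L.Relations n) (ts : Fin n → L.Term α) (f : α → L.Term β) :
    (R.formula ts : L.Formula α).subst f = R.formula fun i => (ts i).subst f := by
  simp only [Relations.formula, Relations.boundedFormula, BoundedFormula.subst,
    BoundedFormula.mapTermRel, term_relabel_subst, term_subst_relabel]
  rfl

theorem toFormula_subst {n : ℕ} (φ : L.BoundedFormula α n) (f : α → L.Term β) :
    (φ.subst f).toFormula =
      φ.toFormula.subst (Sum.elim (Term.relabel Sum.inl ∘ f) (Term.var ∘ Sum.inr)) := by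
  induction φ with
  | falsum => rfl
  | equal t₁ t₂ => exact (subst_equal _ _ _).symm
  | rel R ts => exact (subst_formula _ _ _).symm
  | imp _ _ ih₁ ih₂ => exact congrArg₂ BoundedFormula.imp ih₁ ih₂
  | @all n φ ih =>
    refine congrArg BoundedFormula.all ?_
    change BoundedFormula.relabel _ (BoundedFormula.toFormula (φ.subst f)) = _
    rw [ih]
    apply relabel_subst_comm
    rintro (x | x)
    · simp only [Sum.elim_inl, Function.comp_apply, Term.relabel_relabel, bsubst, Term.subst]
      rfl
    · simp only [Sum.elim_inr, Function.comp_apply, bsubst, Term.subst, Term.relabel]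
      rcases finSumFinEquiv.symm x with y | y <;> rfl

theorem subst_subst {n : ℕ} (φ : L.BoundedFormula α n) (f : α → L.Term β) (g : β → L.Term γ) :
    (φ.subst f).subst g = φ.subst fun a => (f a).subst g := by
  have key : ∀ (k : ℕ) (t : L.Term (α ⊕ Fin k)),
      bsubst g k (bsubst f k t) = bsubst (fun a => (f a).subst g) k t := by
    intro k t
    simp only [bsubst, term_subst_subst]
    congr 1
    funext x
    rcases x with x | x
    · simp only [Sum.elim_inl, Function.comp_apply, term_relabel_subst, term_subst_relabel]
    · rfl
  induction φ with
  | falsum => rfl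
  | equal t₁ t₂ => exact congrArg₂ BoundedFormula.equal (key _ t₁) (key _ t₂)
  | rel R ts => exact congrArg (BoundedFormula.rel R) (funext fun i => key _ (ts i))
  | imp _ _ ih₁ ih₂ => exact congrArg₂ BoundedFormula.imp ih₁ ih₂
  | all φ ih => exact congrArg BoundedFormula.all ih

theorem subst_congr [DecidableEq α] {n : ℕ} (φ : L.BoundedFormula α n) (f g : α → L.Term β)
    (h : ∀ a ∈ φ.freeVarFinset, f a = g a) : φ.subst f = φ.subst g := by
  have key : ∀ (k : ℕ) (t : L.Term (α ⊕ Fin k)), (∀ a ∈ t.varFinsetLeft, f a = g a) →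
      bsubst f k t = bsubst g k t := by
    intro k t ht
    induction t with
    | var x =>
      rcases x with x | x
      · simp [bsubst, ht x (by simp)]
      · rfl
    | func F ts ih =>
      simp only [bsubst, Term.subst] at ih ⊢
      congr 1; funext i
      exact ih i fun a ha => ht a (by simp only [Term.varFinsetLeft, Finset.mem_biUnion]; exact ⟨i, by simp, ha⟩)
  induction φ with
  | falsum => rfl
  | equal t₁ t₂ =>
    exact congrArg₂ BoundedFormula.equal (key _ t₁ fun a ha => h a (by simp [ha]))
      (key _ t₂ fun a ha => h a (by simp [ha]))
  | rel R ts =>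
    refine congrArg (BoundedFormula.rel R) (funext fun i => key _ (ts i) fun a ha => h a ?_)
    simp only [BoundedFormula.freeVarFinset, Finset.mem_biUnion]
    exact ⟨i, by simp, ha⟩
  | imp _ _ ih₁ ih₂ =>
    exact congrArg₂ BoundedFormula.imp (ih₁ fun a ha => h a (by simp [ha]))
      (ih₂ fun a ha => h a (by simp [ha]))
  | all φ ih => exact congrArg BoundedFormula.all (ih h)

/-- Renaming of free variables. -/
def rename (g : α → β) {n : ℕ} (φ : L.BoundedFormula α n) : L.BoundedFormula β n :=
  φ.subst fun a => Term.var (g a)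

theorem subst_var {n : ℕ} (φ : L.BoundedFormula α n) : φ.subst Term.var = φ := by
  have key : ∀ (k : ℕ) (t : L.Term (α ⊕ Fin k)), bsubst Term.var k t = t := by
    intro k t
    refine Eq.trans ?_ (term_subst_var t)
    unfold bsubst
    congr 1
    funext x
    rcases x with x | x <;> rfl
  induction φ with
  | falsum => rfl
  | equal t₁ t₂ => exact congrArg₂ BoundedFormula.equal (key _ t₁) (key _ t₂)
  | rel R ts => exact congrArg (BoundedFormula.rel R) (funext fun i => key _ (ts i))
  | imp _ _ ih₁ ih₂ => exact congrArg₂ BoundedFormula.imp ih₁ ih₂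
  | all φ ih => exact congrArg BoundedFormula.all ih

theorem rename_inst (g : ℕ → ℕ) (φ : L.BoundedFormula ℕ 1) (t : L.Term ℕ) :
    rename g (inst φ t) = inst (rename g φ) (t.subst fun a => Term.var (g a)) := by
  simp only [rename, inst, toFormula_subst, subst_subst]
  congr 1
  funext x
  rcases x with x | x <;> rfl

theorem rename_liftSentence (g : ℕ → ℕ) (σ : L.Sentence) :
    rename g (liftSentence σ) = liftSentence σ := by
  refine (relabel_subst_comm σ Term.var (Sum.inl ∘ (Empty.elim : Empty → ℕ))
    (Sum.inl ∘ (Empty.elim : Empty → ℕ) : Empty → ℕ ⊕ Fin 0) (fun a => Term.var (g a))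
    (fun x => x.elim)).symm.trans ?_
  rw [subst_var]
  rfl

theorem exists_fresh (Δ : List (L.Formula ℕ)) : ∃ y, ∀ ψ ∈ Δ, y ∉ ψ.freeVarFinset := by
  classical
  obtain ⟨y, hy⟩ := Infinite.exists_notMem_finset (Δ.toFinset.biUnion fun χ => χ.freeVarFinset)
  refine ⟨y, fun χ hχ h => hy ?_⟩
  rw [Finset.mem_biUnion]
  exact ⟨χ, by simpa using hχ, h⟩

/-- Renaming and weakening are proved together because of `all_intro`: its eigenvariable may occur
in the larger context `Δ` and has to be replaced by a fresh one. The induction hypothesis for the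
updated renaming does this, as the old eigenvariable occurs in neither `φ` nor `Γ`. -/
theorem Derivable.rename_weaken {T : L.Theory} {Γ : List (L.Formula ℕ)} {φ : L.Formula ℕ}
    (h : Derivable T Γ φ) : ∀ (g : ℕ → ℕ) (Δ : List (L.Formula ℕ)),
      (∀ ψ ∈ Γ, rename g ψ ∈ Δ) → Derivable T Δ (rename g φ) := by
  induction h with
  | axm h => intro g Δ _; rw [rename_liftSentence]; exact .axm h
  | hyp h => intro g Δ H; exact .hyp (H _ h)
  | imp_intro _ ih =>
    intro g Δ H
    refine .imp_intro (ih g _ ?_)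
    rintro ψ hψ
    rcases List.mem_cons.1 hψ with rfl | hψ
    · exact List.mem_cons_self
    · exact List.mem_cons_of_mem _ (H _ hψ)
  | imp_elim _ _ ih₁ ih₂ => intro g Δ H; exact .imp_elim (ih₁ g Δ H) (ih₂ g Δ H)
  | by_contradiction _ ih =>
    intro g Δ H
    refine .by_contradiction (ih g _ ?_)
    rintro ψ hψ
    rcases List.mem_cons.1 hψ with rfl | hψ
    · exact List.mem_cons_self
    · exact List.mem_cons_of_mem _ (H _ hψ)
  | @all_intro Γ φ x hφ hΓ _ ih =>
    intro g Δ H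
    obtain ⟨y, hy⟩ := exists_fresh ((∀' rename g φ) :: Δ)
    have hc : ∀ {n : ℕ} (ψ : L.BoundedFormula ℕ n), x ∉ ψ.freeVarFinset →
        rename (Function.update g x y) ψ = rename g ψ := fun ψ hψ =>
      subst_congr _ _ _ fun a ha => by
        rw [Function.update_of_ne]
        rintro rfl
        exact hψ ha
    refine .all_intro y (hy _ List.mem_cons_self) (fun ψ hψ => hy ψ (List.mem_cons_of_mem _ hψ)) ?_
    have := ih (Function.update g x y) Δ fun ψ hψ => by rw [hc ψ (hΓ ψ hψ)]; exact H ψ hψ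
    rw [rename_inst, hc φ hφ] at this
    simp only [Term.subst, Function.update_self] at this
    exact this
  | all_elim t _ ih =>
    intro g Δ H
    rw [rename_inst]
    exact .all_elim _ (ih g Δ H)
  | eq_refl t =>
    intro g Δ _
    unfold rename
    rw [subst_equal]
    exact .eq_refl _
  | eq_subst φ _ _ ih₁ ih₂ =>
    intro g Δ H
    have h₁ := ih₁ g Δ H
    have h₂ := ih₂ g Δ H
    rw [rename_inst] at h₂ ⊢
    unfold rename at h₁
    rw [subst_equal] at h₁
    exact .eq_subst _ h₁ h₂

theorem Derivable.weaken {T : L.Theory} {Γ Δ : List (L.Formula ℕ)} {φ : L.Formula ℕ}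
    (h : Derivable T Γ φ) (H : ∀ ψ ∈ Γ, ψ ∈ Δ) : Derivable T Δ φ := by
  have e : ∀ {n : ℕ} (ψ : L.BoundedFormula ℕ n), rename id ψ = ψ := fun ψ => subst_var ψ
  have := h.rename_weaken id Δ fun ψ hψ => by rw [e]; exact H ψ hψ
  rwa [e] at this

theorem Derivable.mono {S T : L.Theory} (hST : S ⊆ T) {Γ : List (L.Formula ℕ)} {φ : L.Formula ℕ}
    (h : Derivable S Γ φ) : Derivable T Γ φ := by
  induction h with
  | axm h => exact .axm (hST h)
  | hyp h => exact .hyp h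
  | imp_intro _ ih => exact .imp_intro ih
  | imp_elim _ _ ih₁ ih₂ => exact .imp_elim ih₁ ih₂
  | by_contradiction _ ih => exact .by_contradiction ih
  | all_intro x hφ hΓ _ ih => exact .all_intro x hφ hΓ ih
  | all_elim t _ ih => exact .all_elim t ih
  | eq_refl t => exact .eq_refl t
  | eq_subst φ _ _ ih₁ ih₂ => exact .eq_subst φ ih₁ ih₂

/-! ### Soundness -/

theorem realize_inst {K : Type} [L.Structure K] (φ : L.BoundedFormula ℕ 1) (t : L.Term ℕ)
    (v : ℕ → K) :
    (inst φ t).Realize v ↔ φ.Realize v fun _ => t.realize v := by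
  unfold inst
  rw [Formula.Realize, BoundedFormula.realize_subst]
  have := BoundedFormula.realize_toFormula φ
    (fun a => (Sum.elim Term.var (fun _ => t) a : L.Term ℕ).realize v)
  rw [Formula.Realize] at this
  rw [this]
  rfl

theorem realize_liftSentence {K : Type} [L.Structure K] (σ : L.Sentence) (v : ℕ → K) :
    (liftSentence σ).Realize v ↔ σ.Realize K := by
  unfold liftSentence
  rw [Formula.realize_relabel, Sentence.Realize]
  exact iff_of_eq (congrArg _ (Subsingleton.elim _ _))

theorem realize_congr {K : Type} [L.Structure K] [DecidableEq α] {n : ℕ}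
    (φ : L.BoundedFormula α n) (v w : α → K) (h : ∀ a ∈ φ.freeVarFinset, v a = w a)
    (xs : Fin n → K) : φ.Realize v xs ↔ φ.Realize w xs := by
  classical
  -- After restriction to the variables on which `v` and `w` agree, both sides become the same
  -- statement.
  have e := BoundedFormula.realize_restrictFreeVar' (φ := φ) (s := {a | v a = w a}) (v := v)
    (xs := xs) (fun a ha => h a (by simpa using ha))
  have e' := BoundedFormula.realize_restrictFreeVar' (φ := φ) (s := {a | v a = w a}) (v := w)
    (xs := xs) (fun a ha => h a (by simpa using ha))
  rw [← e, ← e']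
  refine iff_of_eq (congrArg (fun u => BoundedFormula.Realize _ u xs) ?_)
  funext a
  exact a.2

theorem Derivable.sound {T : L.Theory} {Γ : List (L.Formula ℕ)} {φ : L.Formula ℕ}
    (h : Derivable T Γ φ) (K : Type) [L.Structure K] (hT : ∀ σ ∈ T, Sentence.Realize K σ) :
    ∀ v : ℕ → K, (∀ ψ ∈ Γ, ψ.Realize v) → φ.Realize v := by
  induction h with
  | axm h => intro v _; rw [realize_liftSentence]; exact hT _ h
  | hyp h => intro v H; exact H _ h
  | imp_intro _ ih =>
    intro v H h
    exact ih v (by simpa using ⟨h, H⟩)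
  | imp_elim _ _ ih₁ ih₂ => intro v H; exact ih₁ v H (ih₂ v H)
  | by_contradiction _ ih =>
    intro v H
    by_contra h
    exact ih v (by simpa using ⟨h, H⟩)
  | @all_intro Γ φ x hφ hΓ _ ih =>
    intro v H a
    have := ih (Function.update v x a) fun ψ hψ =>
      (realize_congr ψ _ _ (fun b hb => by
        rw [Function.update_of_ne]; rintro rfl; exact hΓ ψ hψ hb) _).2 (H ψ hψ)
    rw [realize_inst, realize_congr φ _ v] at this
    · convert this using 1
      funext i
      rw [Fin.fin_one_eq_zero i]
      simp [Fin.snoc]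
    · intro b hb
      rw [Function.update_of_ne]; rintro rfl; exact hφ hb
  | all_elim t _ ih =>
    intro v H
    rw [realize_inst]
    convert ih v H (t.realize v) using 1
    funext i
    rw [Fin.fin_one_eq_zero i]
    simp [Fin.snoc]
  | eq_refl t => intro v _; simp
  | eq_subst φ _ _ ih₁ ih₂ =>
    intro v H
    have h₁ := ih₁ v H
    have h₂ := ih₂ v H
    rw [realize_inst] at h₂ ⊢
    rw [Formula.realize_equal] at h₁
    rwa [← h₁]

end Calculus

-- Completeness by a Henkin construction

section Completeness

variable {L : FirstOrder.Language.{0, 0}} {α β : Type}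

/-- The number of connectives and quantifiers of a formula. -/
def rank : ∀ {n : ℕ}, L.BoundedFormula α n → ℕ
  | _, .falsum => 0
  | _, .equal _ _ => 0
  | _, .rel _ _ => 0
  | _, .imp φ ψ => rank φ + rank ψ + 1
  | _, .all φ => rank φ + 1

theorem rank_relabel {m k : ℕ} (g : α → β ⊕ Fin m) (φ : L.BoundedFormula α k) :
    rank (φ.relabel g) = rank φ := by
  induction φ with
  | falsum | equal | rel => rfl
  | imp _ _ ih₁ ih₂ => simp [rank, ih₁, ih₂]
  | all _ ih => rw [BoundedFormula.relabel_all, rank, rank, ih]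

theorem rank_subst {k : ℕ} (f : α → L.Term β) (φ : L.BoundedFormula α k) :
    rank (φ.subst f) = rank φ := by
  induction φ with
  | falsum | equal | rel => rfl
  | imp _ _ ih₁ ih₂ => exact congrArg₂ (fun a b => a + b + 1) ih₁ ih₂
  | all _ ih => exact congrArg (· + 1) ih

theorem rank_toFormula {k : ℕ} (φ : L.BoundedFormula α k) : rank φ.toFormula = rank φ := by
  induction φ with
  | falsum | equal | rel => rfl
  | imp _ _ ih₁ ih₂ => exact congrArg₂ (fun a b => a + b + 1) ih₁ ih₂
  | all _ ih => simp only [BoundedFormula.toFormula, rank, rank_relabel, ih]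

theorem rank_inst (φ : L.BoundedFormula ℕ 1) (t : L.Term ℕ) : rank (inst φ t) = rank φ := by
  rw [inst, rank_subst, rank_toFormula]

variable {T : L.Theory} {Γ : List (L.Formula ℕ)} {φ ψ : L.Formula ℕ}

theorem Derivable.not_intro (h : Derivable T (φ :: Γ) ⊥) : Derivable T Γ (∼φ) := .imp_intro h

theorem Derivable.not_elim (h₁ : Derivable T Γ (∼φ)) (h₂ : Derivable T Γ φ) :
    Derivable T Γ ⊥ := .imp_elim h₁ h₂

theorem Derivable.ex_falso (h : Derivable T Γ ⊥) : Derivable T Γ φ :=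
  .by_contradiction (h.weaken fun _ => List.mem_cons_of_mem _)

/-- The variables themselves serve as Henkin constants. The context is a finite list, so some
variable `x` is fresh, and by `all_intro` a contradiction from `¬χ(x)` would already refute `¬∀χ`.
-/
theorem exists_henkin_step (hΓ : ¬Derivable T Γ ⊥) (φ : L.Formula ℕ) :
    ∃ Δ : List (L.Formula ℕ), (∀ ψ ∈ Γ, ψ ∈ Δ) ∧ ¬Derivable T Δ ⊥ ∧ (φ ∈ Δ ∨ ∼φ ∈ Δ) ∧
      ∀ χ : L.BoundedFormula ℕ 1, φ = ∀' χ → ∼φ ∈ Δ → ∃ x : ℕ, ∼(inst χ (Term.var x)) ∈ Δ := by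
  by_cases h : Derivable T (φ :: Γ) ⊥
  · have hn : ¬Derivable T (∼φ :: Γ) ⊥ := fun h' =>
      hΓ (h.not_intro.not_elim (.by_contradiction h'))
    by_cases hall : ∃ χ : L.BoundedFormula ℕ 1, φ = ∀' χ
    · obtain ⟨χ, rfl⟩ := hall
      obtain ⟨x, hx⟩ := exists_fresh ((∀' χ) :: ∼(∀' χ) :: Γ)
      refine ⟨∼(inst χ (Term.var x)) :: ∼(∀' χ) :: Γ, ?_, ?_, ?_, ?_⟩
      · intro ψ hψ
        exact List.mem_cons_of_mem _ (List.mem_cons_of_mem _ hψ)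
      · intro h'
        refine hn (Derivable.not_elim (.hyp List.mem_cons_self)
          (.all_intro x (hx _ List.mem_cons_self) ?_ (.by_contradiction h')))
        intro ψ hψ
        exact hx ψ (List.mem_cons_of_mem _ hψ)
      · exact .inr (List.mem_cons_of_mem _ List.mem_cons_self)
      · intro χ' e _
        have e : χ = χ' := by injection e
        subst e
        exact ⟨x, List.mem_cons_self⟩
    · refine ⟨∼φ :: Γ, fun ψ => List.mem_cons_of_mem _, hn, .inr List.mem_cons_self, ?_⟩
      intro χ e
      exact absurd ⟨χ, e⟩ hall
  · refine ⟨φ :: Γ, fun ψ => List.mem_cons_of_mem _, h, .inl List.mem_cons_self, ?_⟩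
    intro χ _ hn
    exact absurd (Derivable.not_elim (.hyp hn) (.hyp List.mem_cons_self)) h

/-- A consistent complete set of formulas with witnesses. -/
structure IsHenkin (T : L.Theory) (D : Set (L.Formula ℕ)) : Prop where
  consistent : ∀ Γ : List (L.Formula ℕ), (∀ ψ ∈ Γ, ψ ∈ D) → ¬Derivable T Γ ⊥
  complete : ∀ φ, φ ∈ D ∨ ∼φ ∈ D
  witness : ∀ χ : L.BoundedFormula ℕ 1, ∼(∀' χ) ∈ D → ∃ x : ℕ, ∼(inst χ (Term.var x)) ∈ D

theorem exists_isHenkin [Countable (L.Formula ℕ)] (hΓ : ¬Derivable T Γ ⊥) :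
    ∃ D : Set (L.Formula ℕ), IsHenkin T D ∧ ∀ ψ ∈ Γ, ψ ∈ D := by
  obtain ⟨e, he⟩ := exists_surjective_nat (L.Formula ℕ)
  choose! next h₁ h₂ h₃ h₄ using
    fun (Γ : List (L.Formula ℕ)) (h : ¬Derivable T Γ ⊥) (φ : L.Formula ℕ) => exists_henkin_step h φ
  let G : ℕ → List (L.Formula ℕ) := fun n => n.rec Γ fun n Δ => next Δ (e n)
  have hG : ∀ n, ¬Derivable T (G n) ⊥ := by
    intro n
    induction n with
    | zero => exact hΓ
    | succ n ih => exact h₂ _ ih _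
  have hmono : ∀ m n, m ≤ n → ∀ ψ ∈ G m, ψ ∈ G n := by
    intro m n h
    induction h with
    | refl => exact fun _ => id
    | step _ ih => exact fun ψ hψ => h₁ _ (hG _) _ ψ (ih ψ hψ)
  have hfin : ∀ Δ : List (L.Formula ℕ), (∀ ψ ∈ Δ, ∃ n, ψ ∈ G n) → ∃ n, ∀ ψ ∈ Δ, ψ ∈ G n := by
    intro Δ
    induction Δ with
    | nil => exact fun _ => ⟨0, by simp⟩
    | cons φ Δ ih =>
      intro h
      obtain ⟨n, hn⟩ := ih fun ψ hψ => h ψ (List.mem_cons_of_mem _ hψ)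
      obtain ⟨m, hm⟩ := h φ List.mem_cons_self
      refine ⟨max m n, fun ψ hψ => ?_⟩
      rcases List.mem_cons.1 hψ with rfl | hψ
      · exact hmono _ _ (le_max_left _ _) _ hm
      · exact hmono _ _ (le_max_right _ _) _ (hn _ hψ)
  refine ⟨{ψ | ∃ n, ψ ∈ G n}, ⟨?_, ?_, ?_⟩, fun ψ hψ => ⟨0, hψ⟩⟩
  · intro Δ hΔ h
    obtain ⟨n, hn⟩ := hfin Δ hΔ
    exact hG n (h.weaken hn)
  · intro φ
    obtain ⟨n, rfl⟩ := he φ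
    rcases h₃ _ (hG n) (e n) with h | h
    · exact .inl ⟨n + 1, h⟩
    · exact .inr ⟨n + 1, h⟩
  · rintro χ ⟨m, hm⟩
    obtain ⟨n, hn⟩ := he (∀' χ)
    -- The formula `∼(∀' χ)` may have entered at a stage `m` unrelated to the stage `n` that decides
    -- `∀' χ`. The opposite decision is impossible, since both formulas would lie in the consistent
    -- list at stage `max m (n + 1)`.
    have : ∼(e n) ∈ G (n + 1) := by
      rcases h₃ _ (hG n) (e n) with h | h
      · refine absurd (Derivable.not_elim
          (.hyp (hmono _ _ (le_max_left m (n + 1)) _ hm))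
          (.hyp (hmono _ _ (le_max_right m (n + 1)) (∀' χ) ?_))) (hG _)
        rw [← hn]
        exact h
      · exact h
    obtain ⟨x, hx⟩ := h₄ _ (hG n) (e n) χ hn this
    exact ⟨x, n + 1, hx⟩

theorem IsHenkin.mem_of_derivable {D : Set (L.Formula ℕ)} (hD : IsHenkin T D)
    (hΓ : ∀ ψ ∈ Γ, ψ ∈ D) (h : Derivable T Γ φ) : φ ∈ D := by
  refine (hD.complete φ).resolve_right fun hn => hD.consistent (∼φ :: Γ) ?_
    (Derivable.not_elim (.hyp List.mem_cons_self) (h.weaken fun _ => List.mem_cons_of_mem _))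
  intro ψ hψ
  rcases List.mem_cons.1 hψ with rfl | hψ
  · exact hn
  · exact hΓ ψ hψ

theorem IsHenkin.not_mem_iff {D : Set (L.Formula ℕ)} (hD : IsHenkin T D) : ∼φ ∈ D ↔ φ ∉ D := by
  refine ⟨fun h h' => hD.consistent [∼φ, φ] (by simp [h, h'])
    (Derivable.not_elim (φ := φ) (.hyp (by simp)) (.hyp (by simp))), fun h => ?_⟩
  exact (hD.complete φ).resolve_left h

theorem IsHenkin.bot_notMem {D : Set (L.Formula ℕ)} (hD : IsHenkin T D) :
    (⊥ : L.Formula ℕ) ∉ D :=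
  fun h => hD.consistent [⊥] (by simp [h]) (.hyp (by simp))

theorem IsHenkin.imp_mem_iff {D : Set (L.Formula ℕ)} (hD : IsHenkin T D) :
    (φ ⟹ ψ) ∈ D ↔ (φ ∈ D → ψ ∈ D) := by
  refine ⟨fun h h' => hD.mem_of_derivable (Γ := [φ ⟹ ψ, φ]) (by simp [h, h'])
    (.imp_elim (φ := φ) (.hyp (by simp)) (.hyp (by simp))), fun h => ?_⟩
  by_cases hφ : φ ∈ D
  · exact hD.mem_of_derivable (Γ := [ψ]) (by simp [h hφ]) (.imp_intro (.hyp (by simp)))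
  · exact hD.mem_of_derivable (Γ := [∼φ]) (by simp [hD.not_mem_iff.2 hφ])
      (.imp_intro (Derivable.ex_falso (Derivable.not_elim (φ := φ) (.hyp (by simp)) (.hyp (by simp)))))

theorem IsHenkin.all_mem_iff {D : Set (L.Formula ℕ)} (hD : IsHenkin T D)
    (χ : L.BoundedFormula ℕ 1) : (∀' χ) ∈ D ↔ ∀ x : ℕ, inst χ (Term.var x) ∈ D := by
  refine ⟨fun h x => hD.mem_of_derivable (Γ := [∀' χ]) (by simp [h])
    (.all_elim _ (.hyp (by simp))), fun h => ?_⟩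
  by_contra hn
  obtain ⟨x, hx⟩ := hD.witness χ (hD.not_mem_iff.2 hn)
  exact hD.not_mem_iff.1 hx (h x)

theorem inst_equal (s t : L.Term (ℕ ⊕ Fin 1)) (u : L.Term ℕ) :
    inst (s =' t) u = (s.subst (Sum.elim Term.var fun _ => u)).equal
      (t.subst (Sum.elim Term.var fun _ => u)) := subst_equal _ _ _

/-- `x = y` for variables. -/
def eqVar (x y : ℕ) : L.Formula ℕ := (Term.var x).equal (Term.var y)

theorem IsHenkin.eq_subst {D : Set (L.Formula ℕ)} (hD : IsHenkin T D) {x y : ℕ}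
    (χ : L.BoundedFormula ℕ 1) (h₁ : eqVar x y ∈ D) (h₂ : inst χ (Term.var x) ∈ D) :
    inst χ (Term.var y) ∈ D :=
  hD.mem_of_derivable (Γ := [eqVar x y, inst χ (Term.var x)]) (by simp [h₁, h₂])
    (.eq_subst (s := Term.var x) χ (.hyp (by simp [eqVar])) (.hyp (by simp)))

theorem IsHenkin.eq_refl {D : Set (L.Formula ℕ)} (hD : IsHenkin T D) (x : ℕ) : eqVar x x ∈ D :=
  hD.mem_of_derivable (Γ := []) (by simp) (.eq_refl _)

theorem IsHenkin.eq_symm {D : Set (L.Formula ℕ)} (hD : IsHenkin T D) {x y : ℕ}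
    (h : eqVar x y ∈ D) : eqVar y x ∈ D := by
  have := hD.eq_subst ((&0 : L.Term (ℕ ⊕ Fin 1)) =' Term.var (Sum.inl x)) h
  rw [inst_equal, inst_equal] at this
  exact this (hD.eq_refl x)

theorem IsHenkin.eq_trans {D : Set (L.Formula ℕ)} (hD : IsHenkin T D) {x y z : ℕ}
    (h : eqVar x y ∈ D) (h' : eqVar y z ∈ D) : eqVar x z ∈ D := by
  have := hD.eq_subst ((Term.var (Sum.inl x) : L.Term (ℕ ⊕ Fin 1)) =' &0) h'
  rw [inst_equal, inst_equal] at this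
  exact this h

/-- The equality of a Henkin set, on variables. -/
def IsHenkin.setoid {D : Set (L.Formula ℕ)} (hD : IsHenkin T D) : Setoid ℕ where
  r x y := eqVar x y ∈ D
  iseqv := ⟨hD.eq_refl, hD.eq_symm, hD.eq_trans⟩

/-- `x ∈ y` for variables. -/
def memVar (x y : ℕ) : LSet.Formula ℕ :=
  Relations.formula (L := LSet) MemRel.mem ![Term.var x, Term.var y]

theorem inst_memF (s t : LSet.Term (ℕ ⊕ Fin 1)) (u : LSet.Term ℕ) :
    inst (memF s t) u = Relations.formula (L := LSet) MemRel.mem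
      ![s.subst (Sum.elim Term.var fun _ => u), t.subst (Sum.elim Term.var fun _ => u)] := by
  refine (subst_formula _ _ _).trans (congrArg _ ?_)
  funext i
  fin_cases i <;> rfl

theorem IsHenkin.mem_congr {T : LSet.Theory} {D : Set (LSet.Formula ℕ)} (hD : IsHenkin T D)
    {x y x' y' : ℕ} (hx : eqVar x x' ∈ D) (hy : eqVar y y' ∈ D) (h : memVar x y ∈ D) :
    memVar x' y' ∈ D := by
  have h₁ := hD.eq_subst (memF (&0) (Term.var (Sum.inl y))) hx
  rw [inst_memF, inst_memF] at h₁
  have h₂ := hD.eq_subst (memF (Term.var (Sum.inl x')) (&0)) hy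
  rw [inst_memF, inst_memF] at h₂
  exact h₂ (h₁ h)

/-- The quotient of the variables by the equality of a Henkin set, as a structure for the language
of set theory. -/
instance IsHenkin.structure {T : LSet.Theory} {D : Set (LSet.Formula ℕ)} (hD : IsHenkin T D) :
    LSet.Structure (Quotient hD.setoid) where
  funMap := fun f => f.elim
  RelMap := fun {n} R => match n, R with
    | _, .mem => fun xs => Quotient.liftOn₂ (xs 0) (xs 1) (fun x y => memVar x y ∈ D)
        fun _ _ _ _ hx hy => propext
          ⟨hD.mem_congr hx hy, hD.mem_congr (hD.eq_symm hx) (hD.eq_symm hy)⟩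

/-- The induction is on `rank` because an instance of `∀' χ` is not a subformula of it, but has
smaller rank by `rank_inst`. Every element of the quotient is the class of a variable, so instances
at variables decide the quantifier. -/
theorem IsHenkin.truth {T : LSet.Theory} {D : Set (LSet.Formula ℕ)} (hD : IsHenkin T D)
    (n : ℕ) : ∀ φ : LSet.Formula ℕ, rank φ = n →
      (φ ∈ D ↔ φ.Realize fun x => (⟦x⟧ : Quotient hD.setoid)) := by
  have hvar : ∀ t : LSet.Term (ℕ ⊕ Fin 0), ∃ x : ℕ, t = Term.var (Sum.inl x) := by
    rintro (⟨x | x⟩ | ⟨f, _⟩)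
    · exact ⟨x, rfl⟩
    · exact x.elim0
    · exact f.elim
  induction n using Nat.strong_induction_on with
  | _ n ih =>
    intro φ hn
    cases φ with
    | falsum => exact ⟨fun h => hD.bot_notMem h, False.elim⟩
    | equal t₁ t₂ =>
      obtain ⟨x, rfl⟩ := hvar t₁
      obtain ⟨y, rfl⟩ := hvar t₂
      exact (Quotient.eq (r := hD.setoid) (x := x) (y := y)).symm
    | rel R ts =>
      cases R
      obtain ⟨x, hx⟩ := hvar (ts 0)
      obtain ⟨y, hy⟩ := hvar (ts 1)
      have : ts = fun i => Term.relabel Sum.inl ((![Term.var x, Term.var y] : Fin 2 → LSet.Term ℕ) i) := by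
        funext i
        fin_cases i
        · exact hx
        · exact hy
      subst this
      exact Iff.rfl
    | imp φ ψ =>
      rw [rank] at hn
      rw [hD.imp_mem_iff, ih _ (by omega) φ rfl, ih _ (by omega) ψ rfl]
      exact Iff.rfl
    | all χ =>
      rw [rank] at hn
      rw [hD.all_mem_iff]
      have : ∀ x : ℕ, (inst χ (Term.var x) ∈ D ↔ χ.Realize (fun x => (⟦x⟧ : Quotient hD.setoid))
          (Fin.snoc (default : Fin 0 → _) ⟦x⟧)) := by
        intro x
        rw [ih _ (by rw [rank_inst]; omega) _ rfl, realize_inst]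
        refine iff_of_eq (congrArg _ ?_)
        funext i
        rw [Fin.fin_one_eq_zero i]
        simp [Fin.snoc]
      simp only [this]
      exact ⟨fun h a => Quotient.inductionOn a h, fun h x => h _⟩

instance {α : Type} [Countable α] : Countable (LSet.Formula α) := by
  have : Countable LSet.Symbols := by
    have h : Function.Injective fun _ : LSet.Symbols => () := by
      rintro (⟨_, f⟩ | ⟨_, R⟩) (⟨_, g⟩ | ⟨_, S⟩) _
      · exact f.elim
      · exact f.elim
      · exact g.elim
      · cases R; cases S; rfl
    exact h.countable
  exact (show Function.Injective fun φ : LSet.Formula α =>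
    (⟨0, φ⟩ : Σ n, LSet.BoundedFormula α n) from fun _ _ h => by simpa using h).countable

theorem exists_model_of_not_proves {T : LSet.Theory} {σ : LSet.Sentence} (h : ¬Proves T σ) :
    ∃ (K : Type) (_ : LSet.Structure K) (_ : Nonempty K),
      (∀ τ ∈ T, Sentence.Realize K τ) ∧ ¬Sentence.Realize K σ := by
  have h' : ¬Derivable T [∼(liftSentence σ)] ⊥ := fun h' => h (.by_contradiction h')
  obtain ⟨D, hD, hσ⟩ := exists_isHenkin h'
  refine ⟨Quotient hD.setoid, inferInstance, ⟨⟦0⟧⟩, fun τ hτ => ?_, fun hs => ?_⟩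
  · rw [← realize_liftSentence τ fun x => (⟦x⟧ : Quotient hD.setoid), ← hD.truth _ _ rfl]
    exact hD.mem_of_derivable (Γ := []) (by simp) (.axm hτ)
  · rw [← realize_liftSentence σ fun x => (⟦x⟧ : Quotient hD.setoid), ← hD.truth _ _ rfl] at hs
    exact hD.not_mem_iff.1 (hσ _ (by simp)) hs

end Completeness

-- Meaning of the basic formulas in a structure

section Semantics

variable {K : Type} [LSet.Structure K] {α β : Type} {n m : ℕ}

/-- Membership in a structure for the language of set theory. -/
def Mem (x y : K) : Prop := Structure.RelMap (L := LSet) MemRel.mem ![x, y]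

/-- Inclusion in a structure for the language of set theory. -/
def Sub (x y : K) : Prop := ∀ z, Mem z x → Mem z y

/-- Transitivity of an element of a structure for the language of set theory. -/
def IsTransSet (x : K) : Prop := ∀ y, Mem y x → ∀ z, Mem z y → Mem z x

/-- `p = {a, b}` -/
def IsPair (p a b : K) : Prop := ∀ z, Mem z p ↔ (z = a ∨ z = b)

/-- `p = ⟨a, b⟩` -/
def IsOPair (p a b : K) : Prop := ∀ z, Mem z p ↔ (IsPair z a a ∨ IsPair z a b)

/-- `⟨a, b⟩ ∈ f` -/
def OPairMem (a b f : K) : Prop := ∃ p, Mem p f ∧ IsOPair p a b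

/-- `f` is an injection from `z` into `u`. -/
def IsInj (f z u : K) : Prop :=
  (∀ p, Mem p f → ∃ a, Mem a z ∧ ∃ b, Mem b u ∧ IsOPair p a b) ∧
    (∀ a, Mem a z → ∃ b, Mem b u ∧ ∀ c, OPairMem a c f ↔ c = b) ∧
      ∀ a a' b, OPairMem a b f ∧ OPairMem a' b f → a = a'

variable (v : α → K) (xs : Fin n → K)

theorem realize_memF (s t : LSet.Term (α ⊕ Fin n)) :
    (memF s t).Realize v xs ↔ Mem (s.realize (Sum.elim v xs)) (t.realize (Sum.elim v xs)) :=
  BoundedFormula.realize_rel₂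

theorem realize_up (t : LSet.Term (α ⊕ Fin n)) (a : K) :
    (up t).realize (Sum.elim v (Fin.snoc xs a : Fin (n + 1) → K)) = t.realize (Sum.elim v xs) := by
  rw [up, Term.realize_relabel]
  congr 1
  funext x
  rcases x with x | x <;> simp

theorem realize_last (a : K) :
    (last : LSet.Term (α ⊕ Fin (n + 1))).realize (Sum.elim v (Fin.snoc xs a : Fin (n + 1) → K)) =
      a := by
  simp [last]

theorem realize_free (a : α) : (free a : LSet.Term (α ⊕ Fin n)).realize (Sum.elim v xs) = v a := rfl

theorem realize_ballMem (t : LSet.Term (α ⊕ Fin n)) (φ : LSet.BoundedFormula α (n + 1)) :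
    (ballMem t φ).Realize v xs ↔
      ∀ a, Mem a (t.realize (Sum.elim v xs)) → φ.Realize v (Fin.snoc xs a) := by
  simp [ballMem, realize_memF, realize_up, realize_last]

theorem realize_bexMem (t : LSet.Term (α ⊕ Fin n)) (φ : LSet.BoundedFormula α (n + 1)) :
    (bexMem t φ).Realize v xs ↔
      ∃ a, Mem a (t.realize (Sum.elim v xs)) ∧ φ.Realize v (Fin.snoc xs a) := by
  simp [bexMem, realize_memF, realize_up, realize_last]

theorem realize_subF (s t : LSet.Term (α ⊕ Fin n)) :
    (subF s t).Realize v xs ↔ Sub (s.realize (Sum.elim v xs)) (t.realize (Sum.elim v xs)) := by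
  simp [subF, realize_ballMem, realize_memF, realize_up, realize_last, Sub]

theorem realize_ballSub (t : LSet.Term (α ⊕ Fin n)) (φ : LSet.BoundedFormula α (n + 1)) :
    (ballSub t φ).Realize v xs ↔
      ∀ a, Sub a (t.realize (Sum.elim v xs)) → φ.Realize v (Fin.snoc xs a) := by
  simp [ballSub, realize_subF, realize_up, realize_last]

theorem realize_bexSub (t : LSet.Term (α ⊕ Fin n)) (φ : LSet.BoundedFormula α (n + 1)) :
    (bexSub t φ).Realize v xs ↔
      ∃ a, Sub a (t.realize (Sum.elim v xs)) ∧ φ.Realize v (Fin.snoc xs a) := by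
  simp [bexSub, realize_subF, realize_up, realize_last]

theorem realize_transF (t : LSet.Term (α ⊕ Fin n)) :
    (transF t).Realize v xs ↔ IsTransSet (t.realize (Sum.elim v xs)) := by
  simp [transF, realize_ballMem, realize_memF, realize_up, realize_last, IsTransSet]

theorem realize_upairF (p a b : LSet.Term (α ⊕ Fin n)) :
    (upairF p a b).Realize v xs ↔ IsPair (p.realize (Sum.elim v xs)) (a.realize (Sum.elim v xs))
      (b.realize (Sum.elim v xs)) := by
  simp [upairF, realize_memF, realize_up, realize_last, IsPair]

theorem realize_opairF (p a b : LSet.Term (α ⊕ Fin n)) :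
    (opairF p a b).Realize v xs ↔ IsOPair (p.realize (Sum.elim v xs)) (a.realize (Sum.elim v xs))
      (b.realize (Sum.elim v xs)) := by
  simp [opairF, realize_upairF, realize_memF, realize_up, realize_last, IsOPair]

theorem realize_opairMemF (a b f : LSet.Term (α ⊕ Fin n)) :
    (opairMemF a b f).Realize v xs ↔ OPairMem (a.realize (Sum.elim v xs))
      (b.realize (Sum.elim v xs)) (f.realize (Sum.elim v xs)) := by
  simp [opairMemF, realize_bexMem, realize_opairF, realize_up, realize_last, OPairMem]

theorem realize_plug {ι : Type} (g : ι → α ⊕ Fin n) (φ : LSet.Formula ι) :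
    (plug g φ).Realize v xs ↔ φ.Realize (Sum.elim v xs ∘ g) := by
  refine BoundedFormula.realize_relabel.trans ?_
  rw [Formula.Realize]
  exact iff_of_eq (congrArg₂ _ rfl (Subsingleton.elim _ _))

theorem realize_univClosure {k : ℕ} (φ : LSet.Formula (Fin k)) :
    Sentence.Realize K (univClosure φ) ↔ ∀ z : Fin k → K, φ.Realize z := by
  unfold univClosure Sentence.Realize
  rw [BoundedFormula.realize_alls]
  exact forall_congr' fun z => realize_plug _ _ _ _

theorem realize_injectionF (w : Fin 3 → K) :
    BoundedFormula.Realize injectionF w default ↔ IsInj (w 0) (w 1) (w 2) := by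
  simp [injectionF, realize_bexMem, realize_ballMem, realize_opairF,
    realize_opairMemF, realize_free, IsInj, Fin.snoc]

end Semantics

-- Meaning of the axioms in a structure

section Axioms

variable (K : Type) [LSet.Structure K]

theorem realize_extensionality : Sentence.Realize K extensionality ↔
    ∀ x y : K, (∀ z, Mem z x ↔ Mem z y) → x = y := by
  simp [extensionality, Sentence.Realize, Formula.Realize, realize_memF, Fin.snoc]

theorem realize_emptyset : Sentence.Realize K emptyset ↔ ∃ x : K, ∀ y, ¬Mem y x := by
  simp [emptyset, Sentence.Realize, Formula.Realize, realize_memF, Fin.snoc]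

theorem realize_pairing : Sentence.Realize K pairing ↔ ∀ x y : K, ∃ z, IsPair z x y := by
  simp [pairing, Sentence.Realize, Formula.Realize, realize_upairF, Fin.snoc]

theorem realize_union : Sentence.Realize K union ↔
    ∀ x : K, ∃ y, ∀ z, Mem z y ↔ ∃ w, Mem w x ∧ Mem z w := by
  simp [union, Sentence.Realize, Formula.Realize, realize_bexMem, realize_memF, Fin.snoc]

theorem realize_setDifference : Sentence.Realize K setDifference ↔
    ∀ x y : K, ∃ z, ∀ u, Mem u z ↔ Mem u x ∧ ¬Mem u y := by
  simp [setDifference, Sentence.Realize, Formula.Realize, realize_memF, Fin.snoc]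

theorem realize_powerset : Sentence.Realize K powerset ↔
    ∀ x : K, ∃ y, ∀ z, Mem z y ↔ Sub z x := by
  simp [powerset, Sentence.Realize, Formula.Realize, realize_memF, realize_subF, Fin.snoc]

theorem realize_transitiveContainment : Sentence.Realize K transitiveContainment ↔
    ∀ x : K, ∃ y, IsTransSet y ∧ Sub x y := by
  simp [transitiveContainment, Sentence.Realize, Formula.Realize, realize_transF, realize_subF,
    Fin.snoc]

theorem realize_infinity : Sentence.Realize K infinity ↔
    ∃ x : K, (∃ e, Mem e x ∧ ∀ z, ¬Mem z e) ∧
      ∀ y, Mem y x → ∃ s, Mem s x ∧ ∀ z, Mem z s ↔ (Mem z y ∨ z = y) := by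
  simp [infinity, Sentence.Realize, Formula.Realize, realize_memF, realize_bexMem, realize_ballMem,
    Fin.snoc]

theorem realize_setFoundation : Sentence.Realize K setFoundation ↔
    ∀ z : K, (∃ x, Mem x z) → ∃ y, Mem y z ∧ ∀ x, Mem x y → ¬Mem x z := by
  simp [setFoundation, Sentence.Realize, Formula.Realize, realize_memF, realize_ballMem, Fin.snoc]

theorem realize_choice : Sentence.Realize K choice ↔
    ∀ x : K, (∀ y, Mem y x → ∃ z, Mem z y) →
      (∀ y, Mem y x → ∀ y', Mem y' x → (∃ z, Mem z y ∧ Mem z y') → y = y') →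
        ∃ c, ∀ y, Mem y x → ∃ z, ∀ z', (Mem z' y ∧ Mem z' c) ↔ z' = z := by
  simp [choice, Sentence.Realize, Formula.Realize, realize_memF, realize_ballMem, Fin.snoc]

theorem realize_axiomH : Sentence.Realize K axiomH ↔
    ∀ u : K, ∃ T, IsTransSet T ∧
      ∀ z, IsTransSet z → (∃ f, IsInj f z u) → Sub z T := by
  simp [axiomH, Sentence.Realize, Formula.Realize, realize_transF, realize_subF, realize_plug,
    realize_injectionF, Fin.snoc]

theorem realize_separation (C : FormulaClass) : (∀ τ ∈ separation C, Sentence.Realize K τ) ↔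
    ∀ (k : ℕ) (φ : LSet.Formula (Fin k ⊕ Fin 1)), C _ _ φ → ∀ (z : Fin k → K) (w : K),
      ∃ y, ∀ x, Mem x y ↔ Mem x w ∧ φ.Realize (Sum.elim z fun _ => x) := by
  have key : ∀ (k : ℕ) (φ : LSet.Formula (Fin k ⊕ Fin 1)),
      Sentence.Realize K (univClosure (∀' ∃' ∀' (memF (&2) (&1) ⇔
        (memF (&2) (&0) ⊓ plug (Sum.map id ![2]) φ)))) ↔ ∀ (z : Fin k → K) (w : K),
      ∃ y, ∀ x, Mem x y ↔ Mem x w ∧ φ.Realize (Sum.elim z fun _ => x) := by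
    intro k φ
    rw [realize_univClosure]
    refine forall_congr' fun z => ?_
    simp only [Formula.Realize, BoundedFormula.realize_all, BoundedFormula.realize_ex,
      BoundedFormula.realize_iff, BoundedFormula.realize_inf, realize_memF, realize_plug]
    refine forall_congr' fun w => exists_congr fun y => forall_congr' fun x => ?_
    have : (Sum.elim z (Fin.snoc (Fin.snoc (Fin.snoc default w) y) x : Fin 3 → K) ∘
        Sum.map id ![2] : Fin k ⊕ Fin 1 → K) = Sum.elim z fun _ => x := by
      funext i
      rcases i with i | i
      · rfl
      · fin_cases i
        rfl
    rw [this]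
    rfl
  constructor
  · intro h k φ hφ
    exact (key k φ).1 (h _ ⟨k, φ, hφ, rfl⟩)
  · rintro h τ ⟨k, φ, hφ, rfl⟩
    exact (key k φ).2 (h k φ hφ)

theorem realize_collection (C : FormulaClass) : (∀ τ ∈ collection C, Sentence.Realize K τ) ↔
    ∀ (k : ℕ) (φ : LSet.Formula (Fin k ⊕ Fin 2)), C _ _ φ → ∀ (z : Fin k → K) (w : K),
      (∀ x, Mem x w → ∃ y, φ.Realize (Sum.elim z ![x, y])) →
        ∃ c, ∀ x, Mem x w → ∃ y, Mem y c ∧ φ.Realize (Sum.elim z ![x, y]) := by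
  have key : ∀ (k : ℕ) (φ : LSet.Formula (Fin k ⊕ Fin 2)),
      Sentence.Realize K (univClosure (∀' (
      ballMem (&0) (∃' plug (Sum.map id ![1, 2]) φ) ⟹
      ∃' ballMem (&0) (bexMem (&1) (plug (Sum.map id ![2, 3]) φ))))) ↔ ∀ (z : Fin k → K) (w : K),
      (∀ x, Mem x w → ∃ y, φ.Realize (Sum.elim z ![x, y])) →
        ∃ c, ∀ x, Mem x w → ∃ y, Mem y c ∧ φ.Realize (Sum.elim z ![x, y]) := by
    intro k φ
    rw [realize_univClosure]
    refine forall_congr' fun z => ?_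
    simp only [Formula.Realize, BoundedFormula.realize_all, BoundedFormula.realize_ex,
      BoundedFormula.realize_imp, realize_ballMem, realize_bexMem, realize_plug]
    refine forall_congr' fun w => imp_congr (forall_congr' fun x => imp_congr Iff.rfl
      (exists_congr fun y => ?_)) (exists_congr fun c => forall_congr' fun x => imp_congr Iff.rfl
      (exists_congr fun y => and_congr Iff.rfl ?_))
    · refine iff_of_eq (congrArg (fun u => BoundedFormula.Realize φ u default) ?_)
      funext i
      rcases i with i | i
      · rfl
      · fin_cases i <;> rfl
    · refine iff_of_eq (congrArg (fun u => BoundedFormula.Realize φ u default) ?_)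
      funext i
      rcases i with i | i
      · rfl
      · fin_cases i <;> rfl
  constructor
  · intro h k φ hφ
    exact (key k φ).1 (h _ ⟨k, φ, hφ, rfl⟩)
  · rintro h τ ⟨k, φ, hφ, rfl⟩
    exact (key k φ).2 (h k φ hφ)

end Axioms

/-! ### Reindexing of bounded formulas -/

section Reindex

variable {α β : Type}

/-- Extends a change of variables to the scope of one more quantifier. -/
def liftVar {n m : ℕ} (f : α ⊕ Fin n → β ⊕ Fin m) : α ⊕ Fin (n + 1) → β ⊕ Fin (m + 1) :=
  Sum.elim (fun a => Sum.map id Fin.castSucc (f (Sum.inl a)))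
    (Fin.lastCases (Sum.inr (Fin.last m)) fun i => Sum.map id Fin.castSucc (f (Sum.inr i)))

theorem elim_comp_liftVar {K : Type} {n m : ℕ} (f : α ⊕ Fin n → β ⊕ Fin m) (w : β → K)
    (ys : Fin m → K) (a : K) :
    Sum.elim w (Fin.snoc ys a : Fin (m + 1) → K) ∘ liftVar f =
      Sum.elim (Sum.elim w ys ∘ f ∘ Sum.inl) (Fin.snoc (Sum.elim w ys ∘ f ∘ Sum.inr) a) := by
  have h : ∀ x : β ⊕ Fin m, Sum.elim w (Fin.snoc ys a : Fin (m + 1) → K)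
      (Sum.map id Fin.castSucc x) = Sum.elim w ys x := by
    rintro (x | x) <;> simp
  funext x
  rcases x with x | x
  · exact h _
  · induction x using Fin.lastCases with
    | last => simp [liftVar]
    | cast i => simp [liftVar, h]

/-- Free and loose bound variables may be exchanged or identified. Equivalence in every structure is
enough later on, so the new formula is described by its truth conditions only. -/
theorem Delta0.reindex {n : ℕ} {φ : LSet.BoundedFormula α n} (hφ : Delta0 α n φ) :
    ∀ {m : ℕ} (f : α ⊕ Fin n → β ⊕ Fin m), ∃ ψ : LSet.BoundedFormula β m, Delta0 β m ψ ∧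
      ∀ (K : Type) [LSet.Structure K] (w : β → K) (ys : Fin m → K), ψ.Realize w ys ↔
        φ.Realize (Sum.elim w ys ∘ f ∘ Sum.inl) (Sum.elim w ys ∘ f ∘ Sum.inr) := by
  induction hφ with
  | atomic h =>
    intro m f
    have e : ∀ (K : Type) (w : β → K) (ys : Fin m → K),
      Sum.elim (Sum.elim w ys ∘ f ∘ Sum.inl) (Sum.elim w ys ∘ f ∘ Sum.inr) = Sum.elim w ys ∘ f :=
      fun K w ys => by funext x; rcases x with x | x <;> rfl
    cases h with
    | equal s t =>
      refine ⟨s.relabel f =' t.relabel f, .atomic (.equal _ _), fun K _ w ys => ?_⟩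
      simp [e]
    | rel R ts =>
      refine ⟨R.boundedFormula fun i => (ts i).relabel f, .atomic (.rel _ _), fun K _ w ys => ?_⟩
      simp [e]
  | falsum => intro m f; exact ⟨⊥, .falsum, fun K _ w ys => Iff.rfl⟩
  | imp _ _ ih₁ ih₂ =>
    intro m f
    obtain ⟨ψ₁, h₁, e₁⟩ := ih₁ f
    obtain ⟨ψ₂, h₂, e₂⟩ := ih₂ f
    exact ⟨ψ₁ ⟹ ψ₂, .imp h₁ h₂, fun K _ w ys => by
      rw [BoundedFormula.realize_imp, BoundedFormula.realize_imp, e₁, e₂]⟩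
  | ballMem t _ ih =>
    intro m f
    obtain ⟨ψ, h, e⟩ := ih (liftVar f)
    refine ⟨WeakSetTheory.ballMem (t.relabel f) ψ, .ballMem _ h, fun K _ w ys => ?_⟩
    rw [realize_ballMem, realize_ballMem]
    refine forall_congr' fun a => ?_
    rw [e, ← Function.comp_assoc, ← Function.comp_assoc, elim_comp_liftVar, Term.realize_relabel]
    refine imp_congr (iff_of_eq (congrArg _ (congrArg (fun u => t.realize u) ?_))) Iff.rfl
    funext x; rcases x with x | x <;> rfl
  | bexMem t _ ih =>
    intro m f
    obtain ⟨ψ, h, e⟩ := ih (liftVar f)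
    refine ⟨WeakSetTheory.bexMem (t.relabel f) ψ, .bexMem _ h, fun K _ w ys => ?_⟩
    rw [realize_bexMem, realize_bexMem]
    refine exists_congr fun a => ?_
    rw [e, ← Function.comp_assoc, ← Function.comp_assoc, elim_comp_liftVar, Term.realize_relabel]
    refine and_congr (iff_of_eq (congrArg _ (congrArg (fun u => t.realize u) ?_))) Iff.rfl
    funext x; rcases x with x | x <;> rfl

theorem Delta0.and {n : ℕ} {φ ψ : LSet.BoundedFormula α n} (h₁ : Delta0 α n φ)
    (h₂ : Delta0 α n ψ) : Delta0 α n (φ ⊓ ψ) :=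
  .imp (.imp h₁ (.imp h₂ .falsum)) .falsum

theorem Delta0.or {n : ℕ} {φ ψ : LSet.BoundedFormula α n} (h₁ : Delta0 α n φ)
    (h₂ : Delta0 α n ψ) : Delta0 α n (φ ⊔ ψ) :=
  .imp (.imp h₁ .falsum) h₂

theorem Delta0.delta0P {n : ℕ} {φ : LSet.BoundedFormula α n} (h : Delta0 α n φ) :
    Delta0P α n φ := by
  induction h with
  | atomic h => exact .atomic h
  | falsum => exact .falsum
  | imp _ _ ih₁ ih₂ => exact .imp ih₁ ih₂
  | ballMem t _ ih => exact .ballMem t ih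
  | bexMem t _ ih => exact .bexMem t ih

end Reindex

-- Initial substructures and limits of towers

section Initial

variable {K : Type} [LSet.Structure K]

/-- Every subset is a structure for the language of set theory. -/
instance subStructure (N : Set K) : LSet.Structure N where
  funMap := fun f => f.elim
  RelMap := fun R xs => Structure.RelMap R fun i => (xs i : K)

theorem mem_coe {N : Set K} {x y : N} : Mem (x : K) (y : K) ↔ Mem x y := by
  refine iff_of_eq (congrArg (Structure.RelMap (L := LSet) MemRel.mem) ?_)
  funext i
  fin_cases i <;> rfl

/-- `N` is transitive and closed under subsets. -/
structure IsInitial (N : Set K) : Prop where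
  mem : ∀ {x y : K}, y ∈ N → Mem x y → x ∈ N
  sub : ∀ {x y : K}, y ∈ N → Sub x y → x ∈ N

theorem realize_coe {N : Set K} {α : Type} (t : LSet.Term α) (v : α → N) :
    ((t.realize v : N) : K) = t.realize fun a => (v a : K) := by
  cases t with
  | var => rfl
  | func f => exact f.elim

variable {N : Set K}

theorem IsInitial.sub_coe (hN : IsInitial N) {x y : N} : Sub (x : K) (y : K) ↔ Sub x y :=
  ⟨fun h z hz => mem_coe.1 (h z (mem_coe.2 hz)),
    fun h z hz => mem_coe.2 (h ⟨z, hN.mem x.2 hz⟩ (mem_coe.1 hz))⟩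

theorem coe_snoc {K : Type} {N : Set K} {n : ℕ} (xs : Fin n → N) (a : N) :
    (fun i => ((Fin.snoc xs a : Fin (n + 1) → N) i : K)) = Fin.snoc (fun i => (xs i : K)) (a : K) := by
  funext i
  induction i using Fin.lastCases <;> simp

theorem coe_elim {K : Type} {N : Set K} {α : Type} {n : ℕ} (v : α → N) (xs : Fin n → N) :
    (fun i => ((Sum.elim v xs i : N) : K)) = Sum.elim (fun i => (v i : K)) fun i => (xs i : K) := by
  funext i
  rcases i with i | i <;> rfl

/-- A quantifier bounded by `∈` or `⊆` with its bound in `N` ranges over the same elements in `N`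
and in `K`. -/
theorem IsInitial.realize_iff (hN : IsInitial N) {α : Type} {n : ℕ} {φ : LSet.BoundedFormula α n}
    (hφ : Delta0P α n φ) (v : α → N) (xs : Fin n → N) :
    φ.Realize v xs ↔ φ.Realize (fun a => (v a : K)) fun i => (xs i : K) := by
  induction hφ with
  | atomic h =>
    cases h with
    | equal s t =>
      rw [BoundedFormula.realize_bdEqual, BoundedFormula.realize_bdEqual, ← coe_elim,
        ← realize_coe, ← realize_coe, Subtype.coe_inj]
    | rel R ts =>
      rw [BoundedFormula.realize_rel, BoundedFormula.realize_rel, ← coe_elim]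
      simp only [← realize_coe]
      exact Iff.rfl
  | falsum => exact Iff.rfl
  | imp _ _ ih₁ ih₂ => exact imp_congr (ih₁ xs) (ih₂ xs)
  | ballMem t _ ih =>
    rw [realize_ballMem, realize_ballMem, ← coe_elim, ← realize_coe]
    refine ⟨fun h a ha => ?_, fun h a ha => ?_⟩
    · have := (ih _).1 (h ⟨a, hN.mem (Subtype.coe_prop _) ha⟩ (mem_coe.1 ha))
      rwa [coe_snoc] at this
    · rw [ih, coe_snoc]
      exact h a (mem_coe.2 ha)
  | bexMem t _ ih =>
    rw [realize_bexMem, realize_bexMem, ← coe_elim, ← realize_coe]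
    refine ⟨fun ⟨a, ha, h⟩ => ⟨a, mem_coe.2 ha, ?_⟩,
      fun ⟨a, ha, h⟩ => ⟨⟨a, hN.mem (Subtype.coe_prop _) ha⟩, mem_coe.1 ha, ?_⟩⟩
    · rw [ih, coe_snoc] at h
      exact h
    · rw [ih, coe_snoc]
      exact h
  | ballSub t _ ih =>
    rw [realize_ballSub, realize_ballSub, ← coe_elim, ← realize_coe]
    refine ⟨fun h a ha => ?_, fun h a ha => ?_⟩
    · have := (ih _).1 (h ⟨a, hN.sub (Subtype.coe_prop _) ha⟩ (hN.sub_coe.1 ha))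
      rwa [coe_snoc] at this
    · rw [ih, coe_snoc]
      exact h a (hN.sub_coe.2 ha)
  | bexSub t _ ih =>
    rw [realize_bexSub, realize_bexSub, ← coe_elim, ← realize_coe]
    refine ⟨fun ⟨a, ha, h⟩ => ⟨a, hN.sub_coe.2 ha, ?_⟩,
      fun ⟨a, ha, h⟩ => ⟨⟨a, hN.sub (Subtype.coe_prop _) ha⟩, hN.sub_coe.1 ha, ?_⟩⟩
    · rw [ih, coe_snoc] at h
      exact h
    · rw [ih, coe_snoc]
      exact h

theorem IsInitial.isTransSet_coe (hN : IsInitial N) {x : N} :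
    IsTransSet (x : K) ↔ IsTransSet x :=
  ⟨fun h y hy z hz => mem_coe.1 (h y (mem_coe.2 hy) z (mem_coe.2 hz)), fun h y hy z hz => by
    have hy' := hN.mem x.2 hy
    exact mem_coe.2 (h ⟨y, hy'⟩ (mem_coe.1 hy) ⟨z, hN.mem hy' hz⟩ (mem_coe.1 hz))⟩

theorem IsInitial.isPair_coe (hN : IsInitial N) {p a b : N} :
    IsPair (p : K) a b ↔ IsPair p a b := by
  refine ⟨fun h z => ?_, fun h z => ⟨fun hz => ?_, fun hz => ?_⟩⟩
  · rw [← mem_coe, h, Subtype.coe_inj, Subtype.coe_inj]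
  · have := (h ⟨z, hN.mem p.2 hz⟩).1 (mem_coe.1 hz)
    simpa only [← Subtype.coe_inj] using this
  · rcases hz with rfl | rfl
    · exact mem_coe.2 ((h a).2 (.inl rfl))
    · exact mem_coe.2 ((h b).2 (.inr rfl))

/-- The axioms of `M`, except separation, in a structure. -/
structure BaseModel (K : Type) [LSet.Structure K] : Prop where
  ext : ∀ x y : K, (∀ z, Mem z x ↔ Mem z y) → x = y
  empty : ∃ x : K, ∀ y, ¬Mem y x
  pair : ∀ x y : K, ∃ z, IsPair z x y
  union : ∀ x : K, ∃ y, ∀ z, Mem z y ↔ ∃ w, Mem w x ∧ Mem z w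
  diff : ∀ x y : K, ∃ z, ∀ u, Mem u z ↔ Mem u x ∧ ¬Mem u y
  pow : ∀ x : K, ∃ y, ∀ z, Mem z y ↔ Sub z x
  tc : ∀ x : K, ∃ y, IsTransSet y ∧ Sub x y
  inf : ∃ x : K, (∃ e, Mem e x ∧ ∀ z, ¬Mem z e) ∧
      ∀ y, Mem y x → ∃ s, Mem s x ∧ ∀ z, Mem z s ↔ (Mem z y ∨ z = y)
  found : ∀ z : K, (∃ x, Mem x z) → ∃ y, Mem y z ∧ ∀ x, Mem x y → ¬Mem x z

theorem realize_M (K : Type) [LSet.Structure K] : (∀ τ ∈ M, Sentence.Realize K τ) ↔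
    BaseModel K ∧ ∀ τ ∈ separation Delta0, Sentence.Realize K τ := by
  constructor
  · intro h
    have h' : ∀ τ ∈ S1 ∪ {transitiveContainment, infinity, setFoundation}, Sentence.Realize K τ :=
      fun τ hτ => h τ (.inl hτ)
    exact ⟨⟨(realize_extensionality K).1 (h' _ (by simp [S1])),
      (realize_emptyset K).1 (h' _ (by simp [S1])),
      (realize_pairing K).1 (h' _ (by simp [S1])),
      (realize_union K).1 (h' _ (by simp [S1])),
      (realize_setDifference K).1 (h' _ (by simp [S1])),
      (realize_powerset K).1 (h' _ (by simp [S1])),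
      (realize_transitiveContainment K).1 (h' _ (by simp)),
      (realize_infinity K).1 (h' _ (by simp)),
      (realize_setFoundation K).1 (h' _ (by simp))⟩, fun τ hτ => h τ (.inr hτ)⟩
  · rintro ⟨h, hs⟩ τ ((hτ | hτ) | hτ)
    · rcases hτ with rfl | rfl | rfl | rfl | rfl | rfl
      · exact (realize_extensionality K).2 h.ext
      · exact (realize_emptyset K).2 h.empty
      · exact (realize_pairing K).2 h.pair
      · exact (realize_union K).2 h.union
      · exact (realize_setDifference K).2 h.diff
      · exact (realize_powerset K).2 h.pow
    · rcases hτ with rfl | rfl | rfl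
      · exact (realize_transitiveContainment K).2 h.tc
      · exact (realize_infinity K).2 h.inf
      · exact (realize_setFoundation K).2 h.found
    · exact hs τ hτ

/-- An increasing sequence of transitive sets, each of which contains all subsets of its
predecessor, and whose first term contains an inductive set. -/
structure IsTower (V : ℕ → K) : Prop where
  trans : ∀ n, IsTransSet (V n)
  pow : ∀ n x, Sub x (V n) → Mem x (V (n + 1))
  inf : ∃ x, Mem x (V 0) ∧ (∃ e, Mem e x ∧ ∀ z, ¬Mem z e) ∧
      ∀ y, Mem y x → ∃ s, Mem s x ∧ ∀ z, Mem z s ↔ (Mem z y ∨ z = y)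

/-- The union of a sequence of sets. -/
def limit (V : ℕ → K) : Set K := {x | ∃ n, Mem x (V n)}

variable {V : ℕ → K}

theorem IsTower.mono (hV : IsTower V) {m n : ℕ} (h : m ≤ n) : Sub (V m) (V n) := by
  induction h with
  | refl => exact fun _ => id
  | step _ ih => exact fun x hx => hV.pow _ _ fun z hz => hV.trans _ x (ih x hx) z hz

theorem IsTower.of_sub (hV : IsTower V) {n : ℕ} {x : K} (h : Sub x (V n)) : x ∈ limit V :=
  ⟨n + 1, hV.pow _ _ h⟩

theorem IsTower.isInitial (hV : IsTower V) : IsInitial (limit V) where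
  mem := fun ⟨n, hn⟩ h => ⟨n, hV.trans n _ hn _ h⟩
  sub := fun ⟨n, hn⟩ h => hV.of_sub fun z hz => hV.trans n _ hn _ (h z hz)

theorem IsTower.exists_bound (hV : IsTower V) {k : ℕ} (xs : Fin k → limit V) :
    ∃ n, ∀ i, Mem (xs i : K) (V n) := by
  choose f hf using fun i => (xs i).2
  exact ⟨Finset.univ.sup f, fun i => hV.mono (Finset.le_sup (Finset.mem_univ i)) _ (hf i)⟩

theorem IsTower.exists_pair (hV : IsTower V) (hK : BaseModel K) (x y : limit V) :
    ∃ z : limit V, IsPair (z : K) x y := by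
  obtain ⟨n, hn⟩ := hV.exists_bound ![x, y]
  obtain ⟨z, hz⟩ := hK.pair x y
  refine ⟨⟨z, hV.of_sub (n := n) fun u hu => ?_⟩, hz⟩
  rcases (hz u).1 hu with rfl | rfl
  · exact hn 0
  · exact hn 1

/-- `IsOPair` quantifies over all of `K`, so transitivity alone does not suffice: the unordered
pairs formed in `K` must belong to the limit. -/
theorem IsTower.isOPair_coe (hV : IsTower V) (hK : BaseModel K) {p a b : limit V} :
    IsOPair (p : K) a b ↔ IsOPair p a b := by
  have hN := hV.isInitial
  have key : ∀ c d : limit V, (∀ z : K, IsPair z (c : K) d → z ∈ limit V) := by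
    intro c d z hz
    obtain ⟨w, hw⟩ := hV.exists_pair hK c d
    have : z = w := hK.ext _ _ fun u => (hz u).trans (hw u).symm
    rw [this]
    exact w.2
  refine ⟨fun h z => ?_, fun h z => ⟨fun hz => ?_, fun hz => ?_⟩⟩
  · rw [← mem_coe, h, hN.isPair_coe, hN.isPair_coe]
  · have := (h ⟨z, hN.mem p.2 hz⟩).1 (mem_coe.1 hz)
    simpa only [← hN.isPair_coe] using this
  · have hzN : z ∈ limit V := by
      rcases hz with hz | hz
      · exact key _ _ _ hz
      · exact key _ _ _ hz
    have := (h ⟨z, hzN⟩).2 (by simpa only [← hN.isPair_coe] using hz)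
    exact mem_coe.2 this

theorem IsTower.exists_opair (hV : IsTower V) (hK : BaseModel K) (x y : limit V) :
    ∃ z : limit V, IsOPair (z : K) x y := by
  obtain ⟨a, ha⟩ := hV.exists_pair hK x x
  obtain ⟨b, hb⟩ := hV.exists_pair hK x y
  obtain ⟨z, hz⟩ := hV.exists_pair hK a b
  refine ⟨z, fun u => (hz u).trans (or_congr ?_ ?_)⟩
  · exact ⟨fun h => h ▸ ha, fun h => hK.ext _ _ fun w => (h w).trans (ha w).symm⟩
  · exact ⟨fun h => h ▸ hb, fun h => hK.ext _ _ fun w => (h w).trans (hb w).symm⟩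

theorem IsTower.opairMem_coe (hV : IsTower V) (hK : BaseModel K) {a b f : limit V} :
    OPairMem (a : K) b f ↔ OPairMem a b f :=
  ⟨fun ⟨p, hp, h⟩ => ⟨⟨p, hV.isInitial.mem f.2 hp⟩, mem_coe.1 hp, (hV.isOPair_coe hK).1 h⟩,
    fun ⟨p, hp, h⟩ => ⟨p, mem_coe.2 hp, (hV.isOPair_coe hK).2 h⟩⟩

theorem isPair_left {p a b : K} (h : IsPair p a b) : Mem a p := (h a).2 (.inl rfl)

theorem isPair_right {p a b : K} (h : IsPair p a b) : Mem b p := (h b).2 (.inr rfl)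

theorem IsOPair.mem_mem (hK : BaseModel K) {p a b : K} (h : IsOPair p a b) :
    ∃ q, Mem q p ∧ Mem a q ∧ Mem b q := by
  obtain ⟨q, hq⟩ := hK.pair a b
  exact ⟨q, (h q).2 (.inr hq), isPair_left hq, isPair_right hq⟩

/-- The components of an ordered pair in `f` are elements of elements of that pair, so transitivity
keeps all quantifiers of `IsInj` inside the limit. -/
theorem IsTower.isInj_coe (hV : IsTower V) (hK : BaseModel K) {f z u : limit V}
    (h : IsInj f z u) : IsInj (f : K) z u := by
  have hN := hV.isInitial
  obtain ⟨h₁, h₂, h₃⟩ := h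
  have hf : ∀ a b : K, OPairMem a b (f : K) → a ∈ limit V ∧ b ∈ limit V := by
    rintro a b ⟨p, hp, h⟩
    obtain ⟨q, hq, ha, hb⟩ := h.mem_mem hK
    have := hN.mem (hN.mem f.2 hp) hq
    exact ⟨hN.mem this ha, hN.mem this hb⟩
  refine ⟨fun p hp => ?_, fun a ha => ?_, fun a a' b ⟨h, h'⟩ => ?_⟩
  · obtain ⟨a, ha, b, hb, h⟩ := h₁ ⟨p, hN.mem f.2 hp⟩ (mem_coe.1 hp)
    exact ⟨a, mem_coe.2 ha, b, mem_coe.2 hb, (hV.isOPair_coe hK).2 h⟩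
  · obtain ⟨b, hb, h⟩ := h₂ ⟨a, hN.mem z.2 ha⟩ (mem_coe.1 ha)
    refine ⟨b, mem_coe.2 hb, fun c => ⟨fun hc => ?_, fun hc => ?_⟩⟩
    · have := (h ⟨c, (hf _ _ hc).2⟩).1 ((hV.opairMem_coe hK).1 hc)
      exact congrArg Subtype.val this
    · subst hc
      exact (hV.opairMem_coe hK (a := ⟨a, hN.mem z.2 ha⟩)).2 ((h b).2 rfl)
  · have := h₃ ⟨a, (hf _ _ h).1⟩ ⟨a', (hf _ _ h').1⟩ ⟨b, (hf _ _ h).2⟩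
      ⟨(hV.opairMem_coe hK).1 h, (hV.opairMem_coe hK).1 h'⟩
    exact congrArg Subtype.val this

theorem IsInj.mono_right {f z u w : K} (h : IsInj f z u) (huw : Sub u w) : IsInj f z w :=
  ⟨fun p hp => let ⟨a, ha, b, hb, h⟩ := h.1 p hp; ⟨a, ha, b, huw b hb, h⟩,
    fun a ha => let ⟨b, hb, h⟩ := h.2.1 a ha; ⟨b, huw b hb, h⟩, h.2.2⟩

theorem IsTower.exists_sub (hV : IsTower V) (x : limit V) : ∃ n, Sub (x : K) (V n) := by
  obtain ⟨n, hn⟩ := x.2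
  exact ⟨n, hV.trans n _ hn⟩

theorem IsTower.mem_coe_iff (hV : IsTower V) {P : K → Prop} {x : limit V} :
    (∃ z, Mem z (x : K) ∧ P z) ↔ ∃ z : limit V, Mem z x ∧ P z :=
  ⟨fun ⟨z, hz, h⟩ => ⟨⟨z, hV.isInitial.mem x.2 hz⟩, mem_coe.1 hz, h⟩,
    fun ⟨z, hz, h⟩ => ⟨z, mem_coe.2 hz, h⟩⟩

/-- Each set that an axiom requires is formed in `K` and turns out to be included in some `V n` or
in an element of the limit, hence belongs to it. Transitive containment is given by the `V n`
themselves, infinity by `V 0`. -/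
theorem IsTower.baseModel (hV : IsTower V) (hK : BaseModel K) : BaseModel (limit V) := by
  have hN := hV.isInitial
  refine ⟨?_, ?_, ?_, ?_, ?_, ?_, ?_, ?_, ?_⟩
  · intro x y h
    refine Subtype.coe_inj.1 (hK.ext _ _ fun z => ⟨fun hz => ?_, fun hz => ?_⟩)
    · exact mem_coe.2 ((h ⟨z, hN.mem x.2 hz⟩).1 (mem_coe.1 hz))
    · exact mem_coe.2 ((h ⟨z, hN.mem y.2 hz⟩).2 (mem_coe.1 hz))
  · obtain ⟨e, he⟩ := hK.empty
    exact ⟨⟨e, hV.of_sub (n := 0) fun z hz => absurd hz (he z)⟩, fun y hy => he _ (mem_coe.2 hy)⟩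
  · intro x y
    obtain ⟨z, hz⟩ := hV.exists_pair hK x y
    exact ⟨z, hN.isPair_coe.1 hz⟩
  · intro x
    obtain ⟨n, hn⟩ := x.2
    obtain ⟨y, hy⟩ := hK.union x
    refine ⟨⟨y, hV.of_sub (n := n) fun z hz => ?_⟩, fun z => ?_⟩
    · obtain ⟨w, hw, hzw⟩ := (hy z).1 hz
      exact hV.trans n w (hV.trans n _ hn w hw) z hzw
    · rw [← mem_coe, hy]
      simp only [← mem_coe (x := z)]
      exact hV.mem_coe_iff
  · intro x y
    obtain ⟨z, hz⟩ := hK.diff x y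
    refine ⟨⟨z, hN.sub x.2 fun u hu => ((hz u).1 hu).1⟩, fun u => ?_⟩
    rw [← mem_coe, hz, mem_coe, mem_coe]
  · intro x
    obtain ⟨n, hn⟩ := hV.exists_sub x
    obtain ⟨y, hy⟩ := hK.pow x
    refine ⟨⟨y, hV.of_sub (n := n + 1) fun z hz => hV.pow _ _ fun u hu => ?_⟩, fun z => ?_⟩
    · exact hn u ((hy z).1 hz u hu)
    · rw [← mem_coe, hy, hN.sub_coe]
  · intro x
    obtain ⟨n, hn⟩ := hV.exists_sub x
    refine ⟨⟨V n, hV.of_sub (n := n) fun _ => id⟩, ?_, ?_⟩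
    · exact hN.isTransSet_coe.1 (hV.trans n)
    · exact hN.sub_coe.1 hn
  · obtain ⟨x, hx, ⟨e, he, he'⟩, h⟩ := hV.inf
    have hxN : x ∈ limit V := ⟨0, hx⟩
    refine ⟨⟨x, hxN⟩, ⟨⟨e, hN.mem hxN he⟩, mem_coe.1 he, fun z hz => he' _ (mem_coe.2 hz)⟩, ?_⟩
    intro y hy
    obtain ⟨s, hs, hs'⟩ := h y (mem_coe.2 hy)
    refine ⟨⟨s, hN.mem hxN hs⟩, mem_coe.1 hs, fun z => ?_⟩
    rw [← mem_coe, hs', mem_coe, Subtype.coe_inj]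
  · rintro z ⟨x, hx⟩
    obtain ⟨y, hy, h⟩ := hK.found z ⟨x, mem_coe.2 hx⟩
    exact ⟨⟨y, hN.mem z.2 hy⟩, mem_coe.1 hy, fun u hu hu' => h u (mem_coe.2 hu) (mem_coe.2 hu')⟩

theorem IsInitial.realize_separation (hN : IsInitial N) {C : FormulaClass}
    (hC : ∀ (k : ℕ) (φ : LSet.Formula (Fin k ⊕ Fin 1)), C _ _ φ → ∀ v : Fin k ⊕ Fin 1 → N,
      φ.Realize v ↔ φ.Realize fun a => (v a : K))
    (h : ∀ τ ∈ separation C, Sentence.Realize K τ) :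
    ∀ τ ∈ separation C, Sentence.Realize N τ := by
  rw [WeakSetTheory.realize_separation] at h ⊢
  intro k φ hφ z w
  obtain ⟨y, hy⟩ := h k φ hφ (fun i => z i) w
  refine ⟨⟨y, hN.sub w.2 fun u hu => ((hy u).1 hu).1⟩, fun x => ?_⟩
  rw [← mem_coe, hy, mem_coe, hC k φ hφ]
  refine and_congr Iff.rfl (iff_of_eq (congrArg _ ?_))
  funext i
  rcases i with i | i <;> rfl

theorem IsInitial.formula_realize_iff (hN : IsInitial N) {α : Type} {φ : LSet.Formula α}
    (hφ : Delta0P α 0 φ) (v : α → N) : φ.Realize v ↔ φ.Realize fun a => (v a : K) :=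
  (hN.realize_iff hφ v default).trans
    (iff_of_eq (congrArg (BoundedFormula.Realize φ _) (Subsingleton.elim _ _)))

theorem IsTower.realize_M (hV : IsTower V) (hK : ∀ τ ∈ M, Sentence.Realize K τ) :
    ∀ τ ∈ M, Sentence.Realize (limit V) τ := by
  rw [WeakSetTheory.realize_M] at hK ⊢
  exact ⟨hV.baseModel hK.1, hV.isInitial.realize_separation
    (fun k φ hφ v => hV.isInitial.formula_realize_iff hφ.delta0P v) hK.2⟩

theorem IsTower.realize_choice (hV : IsTower V) (hK : BaseModel K)
    (h : Sentence.Realize K choice) : Sentence.Realize (limit V) choice := by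
  have hN := hV.isInitial
  rw [WeakSetTheory.realize_choice] at h ⊢
  intro x h₁ h₂
  obtain ⟨c, hc⟩ := h x
    (fun y hy => by
      obtain ⟨z, hz⟩ := h₁ ⟨y, hN.mem x.2 hy⟩ (mem_coe.1 hy)
      exact ⟨z, mem_coe.2 hz⟩)
    (fun y hy y' hy' ⟨z, hz, hz'⟩ => by
      have hyN := hN.mem x.2 hy
      have := h₂ ⟨y, hyN⟩ (mem_coe.1 hy) ⟨y', hN.mem x.2 hy'⟩ (mem_coe.1 hy')
        ⟨⟨z, hN.mem hyN hz⟩, mem_coe.1 hz, mem_coe.1 hz'⟩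
      exact congrArg Subtype.val this)
  -- The choice set `c` of `K` need not lie in the limit. It is replaced by `e = U ∖ (U ∖ c) = U ∩
  -- c` with `U = ⋃x`, which is a subset of an element of the limit.
  obtain ⟨U, hU⟩ := (hV.baseModel hK).union x
  obtain ⟨d, hd⟩ := hK.diff U c
  obtain ⟨e, he⟩ := hK.diff U d
  refine ⟨⟨e, hN.sub U.2 fun u hu => ((he u).1 hu).1⟩, fun y hy => ?_⟩
  have hmem : ∀ z : limit V, Mem z y → (Mem (z : K) e ↔ Mem (z : K) c) := by
    intro z hz
    have hzU : Mem (z : K) U := mem_coe.2 ((hU z).2 ⟨y, hy, hz⟩)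
    rw [he, hd]
    tauto
  obtain ⟨z, hz⟩ := hc y (mem_coe.2 hy)
  have hzN : z ∈ limit V := hN.mem y.2 ((hz z).2 rfl).1
  refine ⟨⟨z, hzN⟩, fun z' => ?_⟩
  rw [← Subtype.coe_inj, ← hz z', mem_coe]
  refine and_congr_right fun h => ?_
  rw [← hmem z' h, ← mem_coe]

/-- Each `u` in the limit is included in some `V n`, so an injection into `u` is one into `V n`, and
the set for `V n` serves for `u`. -/
theorem IsTower.realize_axiomH (hV : IsTower V) (hK : BaseModel K)
    (h : ∀ n, ∃ T, Mem T (V (n + 1)) ∧ IsTransSet T ∧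
      ∀ z, IsTransSet z → (∃ f, IsInj f z (V n)) → Sub z T) :
    Sentence.Realize (limit V) axiomH := by
  have hN := hV.isInitial
  rw [WeakSetTheory.realize_axiomH]
  intro u
  obtain ⟨n, hn⟩ := hV.exists_sub u
  obtain ⟨T, hT, hT', hz⟩ := h n
  refine ⟨⟨T, n + 1, hT⟩, hN.isTransSet_coe.1 hT', fun z hzt ⟨f, hf⟩ => ?_⟩
  exact hN.sub_coe.1 (hz z (hN.isTransSet_coe.2 hzt) ⟨f, (hV.isInj_coe hK hf).mono_right hn⟩)

end Initial

-- Countable saturation and collection in the limit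

section Saturation

/-- A sequence of conditions on `x`, given by one formula with varying parameters, has a solution
as soon as all its finite initial parts do. -/
def CountablySaturated (K : Type) [LSet.Structure K] : Prop :=
  ∀ (β : Type) (ψ : LSet.Formula (β ⊕ Fin 1)) (p : ℕ → β → K),
    (∀ n, ∃ x : K, ∀ j ≤ n, ψ.Realize (Sum.elim (p j) fun _ => x)) →
      ∃ x : K, ∀ n, ψ.Realize (Sum.elim (p n) fun _ => x)

/-- In an ultrapower by a nonprincipal ultrafilter on `ℕ`, choose at coordinate `i` an element that
solves the longest solvable initial part of the conditions up to `i`. By Łoś, conditions `0, …, n`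
are solvable at almost every `i`, and almost every `i` is at least `n`, so the choice solves
condition `n` almost everywhere. -/
theorem exists_countablySaturated (A : Type) [LSet.Structure A] [Nonempty A] :
    ∃ (K : Type) (_ : LSet.Structure K),
      (∀ σ : LSet.Sentence, Sentence.Realize K σ ↔ Sentence.Realize A σ) ∧
        CountablySaturated K := by
  let U : Ultrafilter ℕ := Filter.hyperfilter ℕ
  refine ⟨(U : Filter ℕ).Product fun _ => A, inferInstance, fun σ => ?_, ?_⟩
  · exact (Ultraproduct.sentence_realize (u := U) (M := fun _ => A) σ).trans
      Filter.eventually_const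
  intro β ψ p h
  have hrep : ∀ a : (U : Filter ℕ).Product fun _ => A, ∃ q : ℕ → A,
      (q : (U : Filter ℕ).Product fun _ => A) = a := fun a => Quotient.exists_rep a
  choose q hq using fun n b => hrep (p n b)
  have los : ∀ (n : ℕ) (x : ℕ → A), ψ.Realize (Sum.elim (p n) fun _ =>
      (x : (U : Filter ℕ).Product fun _ => A)) ↔
        ∀ᶠ i in (U : Filter ℕ), ψ.Realize (Sum.elim (fun b => q n b i) fun _ => x i) := by
    intro n x
    have := Ultraproduct.realize_formula_cast (u := U) (M := fun _ => A) ψ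
      (Sum.elim (q n) fun _ => x)
    have e₁ : (fun i : β ⊕ Fin 1 => ((Sum.elim (q n) (fun _ => x) i : ℕ → A) :
        (U : Filter ℕ).Product fun _ => A)) = Sum.elim (p n) fun _ =>
          (x : (U : Filter ℕ).Product fun _ => A) := by
      funext i
      rcases i with i | i
      · exact hq n i
      · rfl
    have e₂ : ∀ a : ℕ, (fun i : β ⊕ Fin 1 => (Sum.elim (q n) (fun _ => x) i : ℕ → A) a) =
        Sum.elim (fun b => q n b a) fun _ => x a := by
      intro a
      funext i
      rcases i with i | i <;> rfl
    rw [e₁] at this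
    simp only [e₂] at this
    exact this
  let P : ℕ → ℕ → A → Prop := fun i n x =>
    ∀ j ≤ n, ψ.Realize (Sum.elim (fun b => q j b i) fun _ => x)
  have hP : ∀ n, ∀ᶠ i in (U : Filter ℕ), ∃ x, P i n x := by
    intro n
    obtain ⟨x, hx⟩ := h n
    obtain ⟨x, rfl⟩ := hrep x
    have : ∀ᶠ i in (U : Filter ℕ), ∀ j ∈ Set.Iic n,
        ψ.Realize (Sum.elim (fun b => q j b i) fun _ => x i) :=
      (Filter.eventually_all_finite (Set.finite_Iic n)).2 fun j hj => (los j x).1 (hx j hj)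
    exact this.mono fun i hi => ⟨x i, hi⟩
  classical
  -- The cutoff at `i` is needed because all conditions may be solvable at coordinate `i`.
  let g : ℕ → ℕ := fun i => Nat.findGreatest (fun n => ∃ x, P i n x) i
  let x : ℕ → A := fun i => Classical.epsilon (P i (g i))
  refine ⟨(x : (U : Filter ℕ).Product fun _ => A), fun n => (los n x).2 ?_⟩
  have hlarge : ∀ᶠ i in (U : Filter ℕ), n ≤ i :=
    Filter.Eventually.filter_mono (Filter.hyperfilter_le_cofinite)
      (by rw [Nat.cofinite_eq_atTop]; exact Filter.eventually_ge_atTop n)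
  filter_upwards [hP n, hlarge] with i hi hni
  have hspec : ∃ x, P i (g i) x :=
    Nat.findGreatest_spec (P := fun n => ∃ x, P i n x) hni hi
  exact Classical.epsilon_spec hspec n (Nat.le_findGreatest hni hi)

variable {K : Type} [LSet.Structure K]

theorem CountablySaturated.exists_bound (hK : CountablySaturated K) {V : ℕ → K}
    (hV : IsTower V) {k : ℕ} (φ : LSet.Formula (Fin k ⊕ Fin 2)) (z : Fin k → K) (w : K)
    (h : ∀ x, Mem x w → ∃ y ∈ limit V, φ.Realize (Sum.elim z ![x, y])) :
    ∃ n, ∀ x, Mem x w → ∃ y, Mem y (V n) ∧ φ.Realize (Sum.elim z ![x, y]) := by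
  by_contra! hn
  -- In `ψ` the parameters are `z`, `w` and `V n`, the unknown is `x`, and `y` becomes the variable
  -- bound by the quantifier over `V n`.
  let g : Fin k ⊕ Fin 2 → ((Fin k ⊕ Fin 2) ⊕ Fin 1) ⊕ Fin 1 :=
    Sum.elim (fun i => Sum.inl (Sum.inl (Sum.inl i))) ![Sum.inl (Sum.inr 0), Sum.inr 0]
  let ψ : LSet.Formula ((Fin k ⊕ Fin 2) ⊕ Fin 1) :=
    memF (free (Sum.inr 0)) (free (Sum.inl (Sum.inr 0))) ⊓
      ballMem (free (Sum.inl (Sum.inr 1))) (∼(plug g φ))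
  have hψ : ∀ (n : ℕ) (x : K), ψ.Realize (Sum.elim (Sum.elim z ![w, V n]) fun _ => x) ↔
      Mem x w ∧ ∀ y, Mem y (V n) → ¬φ.Realize (Sum.elim z ![x, y]) := by
    intro n x
    simp only [ψ, Formula.Realize, BoundedFormula.realize_inf, realize_memF, realize_ballMem,
      BoundedFormula.realize_not, realize_plug, realize_free]
    refine and_congr Iff.rfl (forall_congr' fun y => imp_congr Iff.rfl (not_congr ?_))
    refine iff_of_eq (congrArg (fun u => BoundedFormula.Realize φ u default) ?_)
    funext i
    rcases i with i | i
    · rfl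
    · fin_cases i <;> rfl
  obtain ⟨x, hx⟩ := hK _ ψ (fun n => Sum.elim z ![w, V n]) fun n => by
    obtain ⟨x, hxw, hx⟩ := hn n
    exact ⟨x, fun j hj => (hψ j x).2 ⟨hxw, fun y hy => hx y (hV.mono hj y hy)⟩⟩
  obtain ⟨y, ⟨n, hy⟩, hφ⟩ := h x ((hψ 0 x).1 (hx 0)).1
  exact ((hψ n x).1 (hx n)).2 y hy hφ

/-- Absoluteness moves the hypothesis to `K`, where `exists_bound` gives an `n`; the collecting set
is `V n`, an element of `V (n + 1)`. -/
theorem CountablySaturated.realize_collection (hK : CountablySaturated K) {V : ℕ → K}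
    (hV : IsTower V) {C : FormulaClass}
    (hC : ∀ (k : ℕ) (φ : LSet.Formula (Fin k ⊕ Fin 2)), C _ _ φ → ∀ v : Fin k ⊕ Fin 2 → limit V,
      φ.Realize v ↔ φ.Realize fun a => (v a : K)) :
    ∀ τ ∈ collection C, Sentence.Realize (limit V) τ := by
  rw [WeakSetTheory.realize_collection]
  intro k φ hφ z w h
  have e : ∀ x y : limit V, φ.Realize (Sum.elim z ![x, y]) ↔
      φ.Realize (Sum.elim (fun i => (z i : K)) ![(x : K), (y : K)]) := by
    intro x y
    rw [hC k φ hφ]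
    refine iff_of_eq (congrArg _ ?_)
    funext i
    rcases i with i | i
    · rfl
    · fin_cases i <;> rfl
  have hN := hV.isInitial
  obtain ⟨n, hn⟩ := hK.exists_bound hV φ (fun i => z i) w fun x hx => by
    obtain ⟨y, hy⟩ := h ⟨x, hN.mem w.2 hx⟩ (mem_coe.1 hx)
    exact ⟨y, y.2, (e _ _).1 hy⟩
  refine ⟨⟨V n, hV.of_sub (n := n) fun _ => id⟩, fun x hx => ?_⟩
  obtain ⟨y, hy, hφy⟩ := hn x (mem_coe.2 hx)
  exact ⟨⟨y, n, hy⟩, mem_coe.1 hy, (e _ _).2 hφy⟩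

/-- There are towers whose limit contains given elements and whose successor step realizes a given
condition that is preserved by enlarging. -/
theorem BaseModel.exists_tower (hK : BaseModel K) (R : ℕ → K → K → Prop)
    (hR : ∀ n u, ∃ v, ∀ w, Sub v w → R n u w) {k : ℕ} (a : Fin k → K) :
    ∃ V : ℕ → K, IsTower V ∧ (∀ i, a i ∈ limit V) ∧ ∀ n, R n (V n) (V (n + 1)) := by
  have hsing : ∀ x y : K, ∃ u, Mem x u ∧ Mem y u := fun x y => by
    obtain ⟨u, hu⟩ := hK.pair x y
    exact ⟨u, isPair_left hu, isPair_right hu⟩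
  have hfin : ∀ (k : ℕ) (a : Fin k → K), ∃ u, ∀ i, Mem (a i) u := by
    intro k
    induction k with
    | zero => exact fun _ => ⟨hK.empty.choose, fun i => i.elim0⟩
    | succ k ih =>
      intro a
      obtain ⟨u, hu⟩ := ih (fun i => a i.succ)
      obtain ⟨s, hs, -⟩ := hsing (a 0) (a 0)
      obtain ⟨p, hp, hp'⟩ := hsing u s
      obtain ⟨y, hy⟩ := hK.union p
      refine ⟨y, fun i => (hy _).2 ?_⟩
      refine Fin.cases ⟨s, hp', hs⟩ (fun i => ⟨u, hp, hu i⟩) i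
  have hbase : ∃ v : K, IsTransSet v ∧ (∃ x, Mem x v ∧ (∃ e, Mem e x ∧ ∀ z, ¬Mem z e) ∧
      ∀ y, Mem y x → ∃ s, Mem s x ∧ ∀ z, Mem z s ↔ (Mem z y ∨ z = y)) ∧ ∀ i, Mem (a i) v := by
    obtain ⟨x, hx⟩ := hK.inf
    obtain ⟨u, hu⟩ := hfin (k + 1) (Fin.cons x a)
    obtain ⟨v, hv, huv⟩ := hK.tc u
    exact ⟨v, hv, ⟨x, huv _ (hu 0), hx⟩, fun i => huv _ (hu i.succ)⟩
  -- A transitive set that contains both `v` and the power set of `u` includes each of them, and `R`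
  -- survives the enlargement of `v`.
  have hstep : ∀ n u, ∃ v, IsTransSet v ∧ (∀ x, Sub x u → Mem x v) ∧ R n u v := by
    intro n u
    obtain ⟨v, hv⟩ := hR n u
    obtain ⟨p, hp⟩ := hK.pow u
    obtain ⟨t, ht, ht'⟩ := hsing v p
    obtain ⟨w, hw, htw⟩ := hK.tc t
    exact ⟨w, hw, fun x hx => hw p (htw p ht') x ((hp x).2 hx), hv w (hw v (htw v ht))⟩
  choose s hs₁ hs₂ hs₃ using hstep
  obtain ⟨v, hv₁, hv₂, hv₃⟩ := hbase
  -- The recursion runs over the natural numbers of the metatheory; nothing requires the sequence to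
  -- be definable in `K`.
  let V : ℕ → K := fun n => n.rec v s
  refine ⟨V, ⟨fun n => ?_, fun n => hs₂ n (V n), hv₂⟩, fun i => ⟨0, hv₃ i⟩, fun n => hs₃ n (V n)⟩
  cases n with
  | zero => exact hv₁
  | succ n => exact hs₁ n (V n)

end Saturation

/-! ### Conservativity over `M + H` -/

section Conservativity

variable {K : Type} [LSet.Structure K]

/-- A formula starting with a block of universal quantifiers over `C` fails in a structure only if
it fails at a tuple of elements that refutes its matrix. -/
theorem AllBlock.exists_counterexample {C : FormulaClass} {α : Type} {n : ℕ}
    {φ : LSet.BoundedFormula α n} (hφ : AllBlock C α n φ) (v : α → K) (xs : Fin n → K)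
    (h : ¬φ.Realize v xs) : ∃ (m : ℕ) (ψ : LSet.BoundedFormula α m) (ys : Fin m → K),
      C α m ψ ∧ ¬ψ.Realize v ys ∧ ∀ (N : Set K) (w : α → N) (us : Fin m → N),
        (∀ i, (us i : K) = ys i) → ¬ψ.Realize w us →
          ∃ us' : Fin n → N, (∀ i, (us' i : K) = xs i) ∧ ¬φ.Realize w us' := by
  induction hφ with
  | base hC => exact ⟨_, _, xs, hC, h, fun N w us hus hn => ⟨us, hus, hn⟩⟩
  | all _ ih =>
    rw [BoundedFormula.realize_all] at h
    push Not at h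
    obtain ⟨a, ha⟩ := h
    obtain ⟨m, ψ, ys, hC, hn, H⟩ := ih _ ha
    refine ⟨m, ψ, ys, hC, hn, fun N w us hus hnr => ?_⟩
    obtain ⟨us', hus', hn'⟩ := H N w us hus hnr
    refine ⟨fun i => us' i.castSucc, fun i => by rw [hus']; simp, fun hall => hn' ?_⟩
    have := hall (us' (Fin.last _))
    convert this using 1
    funext i
    refine Fin.lastCases ?_ (fun i => ?_) i <;> simp

/-- Only this upward direction is needed to keep a counterexample: an existential statement false in
`K` stays false in `N`. -/
theorem ExBlock.realize_of_realize_coe {N : Set K} {C : FormulaClass} {α : Type} {n : ℕ}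
    {φ : LSet.BoundedFormula α n} (hφ : ExBlock C α n φ)
    (hC : ∀ (m : ℕ) (ψ : LSet.BoundedFormula α m), C α m ψ → ∀ (v : α → N) (xs : Fin m → N),
      ψ.Realize v xs → ψ.Realize (fun a => (v a : K)) fun i => (xs i : K))
    (v : α → N) (xs : Fin n → N) (h : φ.Realize v xs) :
    φ.Realize (fun a => (v a : K)) fun i => (xs i : K) := by
  induction hφ with
  | base h' => exact hC _ _ h' v xs h
  | ex _ ih =>
    rw [BoundedFormula.realize_ex] at h ⊢
    obtain ⟨a, ha⟩ := h
    have := ih _ ha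
    rw [coe_snoc] at this
    exact ⟨a, this⟩

/-- The common frame of the two conservativity results: a counterexample to a sentence is kept by
passing to a suitable limit of a tower in a countably saturated model. -/
theorem conservative_of_limit {C D : FormulaClass} {S T : LSet.Theory} (hTS : T ⊆ S)
    (hD : ∀ σ, C Empty 0 σ → AllBlock (ExBlock D) Empty 0 σ)
    (H : ∀ (K : Type) [LSet.Structure K], CountablySaturated K →
      (∀ τ ∈ T, Sentence.Realize K τ) → ∀ (k : ℕ) (a : Fin k → K), ∃ N : Set K, N.Nonempty ∧ (∀ i, a i ∈ N) ∧
        (∀ τ ∈ S, Sentence.Realize N τ) ∧ ∀ (m : ℕ) (ψ : LSet.BoundedFormula Empty m),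
          D Empty m ψ → ∀ (v : Empty → N) (xs : Fin m → N), ψ.Realize v xs →
            ψ.Realize (fun a => (v a : K)) fun i => (xs i : K)) :
    ConservativeOver (C Empty 0) S T := by
  intro σ hσ
  refine ⟨fun hS => ?_, fun hT => Derivable.mono hTS hT⟩
  by_contra hn
  obtain ⟨A, _, _, hA, hAσ⟩ := exists_model_of_not_proves hn
  obtain ⟨K, _, hKA, hK⟩ := exists_countablySaturated A
  rw [← hKA] at hAσ
  obtain ⟨m, ψ, ys, hψ, hn', hN⟩ := (hD σ hσ).exists_counterexample default default hAσ
  obtain ⟨N, ⟨c, hc⟩, hys, hNS, hND⟩ := H K hK (fun τ hτ => (hKA τ).2 (hA τ hτ)) m ys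
  obtain ⟨us, -, hus⟩ := hN N default (fun i => ⟨ys i, hys i⟩) (fun _ => rfl) fun h => hn' (by
    have := hψ.realize_of_realize_coe hND _ _ h
    convert this using 1)
  have hNσ : Sentence.Realize N σ := by
    have := hS.sound N hNS (fun _ => ⟨c, hc⟩) (by simp)
    rwa [realize_liftSentence] at this
  refine hus ?_
  exact (iff_of_eq (congrArg₂ (BoundedFormula.Realize σ) (Subsingleton.elim _ _)
    (Subsingleton.elim _ _))).1 hNσ

theorem conservative_MH : ConservativeOver (TakahashiPi 2 Empty 0) (MH ∪ collection Delta0P) MH := by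
  refine conservative_of_limit (D := Delta0P) Set.subset_union_left (fun σ h => ?_) ?_
  · simpa only [TakahashiPi, PiOver, SigmaOver] using h
  intro K _ hK hT k a
  have hM : ∀ τ ∈ M, Sentence.Realize K τ := fun τ hτ => hT τ (.inl hτ)
  have hB := ((realize_M K).1 hM).1
  have hH := (realize_axiomH K).1 (hT _ (.inr rfl))
  -- The set `T` is required to be an element of `v`, which makes the condition monotone in `v` and
  -- puts `T` into the limit.
  let R : ℕ → K → K → Prop := fun _ u v => ∃ T, Mem T v ∧ IsTransSet T ∧
      ∀ z, IsTransSet z → (∃ f, IsInj f z u) → Sub z T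
  obtain ⟨V, hV, haV, hR⟩ := hB.exists_tower R (fun n u => by
    obtain ⟨T, hT⟩ := hH u
    obtain ⟨v, hv⟩ := hB.pair T T
    exact ⟨v, fun w hw => ⟨T, hw _ (isPair_left hv), hT⟩⟩) a
  refine ⟨limit V, ⟨V 0, hV.of_sub (n := 0) fun _ => id⟩, haV, ?_, fun m ψ hψ v xs h => (hV.isInitial.realize_iff hψ v xs).1 h⟩
  rintro τ ((hτ | hτ) | hτ)
  · exact hV.realize_M hM τ hτ
  · rw [Set.mem_singleton_iff.1 hτ]
    exact hV.realize_axiomH hB hR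
  · exact hK.realize_collection hV (fun k φ hφ v => hV.isInitial.formula_realize_iff hφ v) τ hτ

end Conservativity

/-! ### Pairing by bounded formulas -/

section Pairing

variable {K : Type} [LSet.Structure K] {α : Type} {n : ℕ}

theorem IsOPair.inj (hK : BaseModel K) {p a b a' b' : K} (h : IsOPair p a b)
    (h' : IsOPair p a' b') : a = a' ∧ b = b' := by
  obtain ⟨s, hs⟩ := hK.pair a a
  have ha : a = a' := by
    have : a' = a ∨ a' = a := (hs a').1 (by
      rcases (h' s).1 ((h s).2 (.inl hs)) with h | h <;> exact isPair_left h)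
    tauto
  subst ha
  obtain ⟨t, ht⟩ := hK.pair a b
  obtain ⟨t', ht'⟩ := hK.pair a b'
  have h₁ : b = a ∨ b = b' := by
    rcases (h' t).1 ((h t).2 (.inr ht)) with h | h
    · exact .inl (by simpa using (h b).1 (isPair_right ht))
    · exact (h b).1 (isPair_right ht)
  have h₂ : b' = a ∨ b' = b := by
    rcases (h t').1 ((h' t').2 (.inr ht')) with h | h
    · exact .inl (by simpa using (h b').1 (isPair_right ht'))
    · exact (h b').1 (isPair_right ht')
  refine ⟨rfl, ?_⟩
  rcases h₁ with rfl | rfl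
  · rcases h₂ with rfl | rfl <;> rfl
  · rfl

/-- `p = {a, b}`, as a bounded formula. -/
def pairD0 (p a b : LSet.Term (α ⊕ Fin n)) : LSet.BoundedFormula α n :=
  memF a p ⊓ (memF b p ⊓ ballMem p (last =' up a ⊔ last =' up b))

/-- `p = ⟨a, b⟩`, as a bounded formula. -/
def opairD0 (p a b : LSet.Term (α ⊕ Fin n)) : LSet.BoundedFormula α n :=
  bexMem p (pairD0 last (up a) (up a)) ⊓ (bexMem p (pairD0 last (up a) (up b)) ⊓
    ballMem p (pairD0 last (up a) (up a) ⊔ pairD0 last (up a) (up b)))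

theorem delta0_memF (s t : LSet.Term (α ⊕ Fin n)) : Delta0 α n (memF s t) := .atomic (.rel _ _)

theorem delta0_pairD0 (p a b : LSet.Term (α ⊕ Fin n)) : Delta0 α n (pairD0 p a b) :=
  (delta0_memF _ _).and ((delta0_memF _ _).and
    (.ballMem _ (.or (.atomic (.equal _ _)) (.atomic (.equal _ _)))))

theorem delta0_opairD0 (p a b : LSet.Term (α ⊕ Fin n)) : Delta0 α n (opairD0 p a b) :=
  .and (.bexMem _ (delta0_pairD0 _ _ _)) (.and (.bexMem _ (delta0_pairD0 _ _ _))
    (.ballMem _ (.or (delta0_pairD0 _ _ _) (delta0_pairD0 _ _ _))))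

theorem realize_pairD0 (p a b : LSet.Term (α ⊕ Fin n)) (v : α → K) (xs : Fin n → K) :
    (pairD0 p a b).Realize v xs ↔ IsPair (p.realize (Sum.elim v xs)) (a.realize (Sum.elim v xs))
      (b.realize (Sum.elim v xs)) := by
  simp only [pairD0, BoundedFormula.realize_inf, realize_memF, realize_ballMem,
    BoundedFormula.realize_sup, BoundedFormula.realize_bdEqual, realize_up, realize_last]
  refine ⟨fun ⟨ha, hb, h⟩ z => ⟨h z, ?_⟩,
    fun h => ⟨isPair_left h, isPair_right h, fun z => (h z).1⟩⟩
  rintro (rfl | rfl)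
  · exact ha
  · exact hb

theorem realize_opairD0 (hK : BaseModel K) (p a b : LSet.Term (α ⊕ Fin n)) (v : α → K)
    (xs : Fin n → K) : (opairD0 p a b).Realize v xs ↔ IsOPair (p.realize (Sum.elim v xs))
      (a.realize (Sum.elim v xs)) (b.realize (Sum.elim v xs)) := by
  simp only [opairD0, BoundedFormula.realize_inf, realize_bexMem, realize_ballMem,
    BoundedFormula.realize_sup, realize_pairD0, realize_up, realize_last]
  have huniq : ∀ {z w c d : K}, IsPair z c d → IsPair w c d → z = w := fun hz hw =>
    hK.ext _ _ fun u => (hz u).trans (hw u).symm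
  constructor
  · rintro ⟨⟨q, hq, hq'⟩, ⟨r, hr, hr'⟩, h⟩ z
    refine ⟨h z, ?_⟩
    rintro (hz | hz)
    · rwa [huniq hz hq']
    · rwa [huniq hz hr']
  · intro h
    obtain ⟨q, hq⟩ := hK.pair (a.realize (Sum.elim v xs)) (a.realize (Sum.elim v xs))
    obtain ⟨r, hr⟩ := hK.pair (a.realize (Sum.elim v xs)) (b.realize (Sum.elim v xs))
    exact ⟨⟨q, (h q).2 (.inl hq), hq⟩, ⟨r, (h r).2 (.inr hr), hr⟩, fun z => (h z).1⟩

theorem BaseModel.exists_insert (hK : BaseModel K) (a Y : K) : ∃ Z, Mem a Z ∧ Sub Y Z := by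
  obtain ⟨s, hs⟩ := hK.pair a a
  obtain ⟨p, hp⟩ := hK.pair s Y
  obtain ⟨Z, hZ⟩ := hK.union p
  exact ⟨Z, (hZ _).2 ⟨s, isPair_left hp, isPair_left hs⟩,
    fun z hz => (hZ z).2 ⟨Y, isPair_right hp, hz⟩⟩

end Pairing

/-! ### `Σ₁`-elementary towers -/

section SigmaOne

variable {K : Type} [LSet.Structure K]

/-- The witnesses of a block of existential quantifiers can be bounded by a set. -/
theorem ExBlock.exists_bounded (hK : BaseModel K) {α : Type} {n : ℕ}
    {φ : LSet.BoundedFormula α n} (hφ : ExBlock Delta0 α n φ) :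
    ∃ δ : LSet.BoundedFormula (α ⊕ Fin 1) n, Delta0 (α ⊕ Fin 1) n δ ∧
      ∀ (v : α → K) (xs : Fin n → K),
        (∀ Y, δ.Realize (Sum.elim v fun _ => Y) xs → φ.Realize v xs) ∧
          (φ.Realize v xs → ∃ Y, ∀ Z, Sub Y Z → δ.Realize (Sum.elim v fun _ => Z) xs) := by
  induction hφ with
  | base h =>
    obtain ⟨δ, hδ, e⟩ := h.reindex (Sum.map (Sum.inl : α → α ⊕ Fin 1) id)
    refine ⟨δ, hδ, fun v xs => ⟨fun Y hY => (e K _ xs).1 hY, fun h => ?_⟩⟩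
    obtain ⟨Y, -⟩ := hK.empty
    exact ⟨Y, fun Z _ => (e K _ xs).2 h⟩
  | ex _ ih =>
    obtain ⟨δ, hδ, e⟩ := ih
    refine ⟨bexMem (free (Sum.inr 0)) δ, .bexMem _ hδ, fun v xs => ⟨fun Y hY => ?_, fun h => ?_⟩⟩
    · rw [realize_bexMem] at hY
      obtain ⟨a, -, ha⟩ := hY
      exact BoundedFormula.realize_ex.2 ⟨a, (e v _).1 Y ha⟩
    · obtain ⟨a, ha⟩ := BoundedFormula.realize_ex.1 h
      obtain ⟨Y, hY⟩ := (e v _).2 ha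
      -- Since `δ` stays true for all sets that include `Y`, a single set can bound all quantifiers
      -- of the block.
      obtain ⟨Y', ha', hYY'⟩ := hK.exists_insert a Y
      refine ⟨Y', fun Z hZ => ?_⟩
      rw [realize_bexMem]
      exact ⟨a, hZ a ha', hY Z fun z hz => hZ z (hYY' z hz)⟩

/-- Collection alone would need a witness for every `p ∈ u`. `Σ₁`-separation first cuts out the set
of those `p` that have one, and `Δ₀`-collection is applied to it. -/
theorem exists_reflecting (hsep : ∀ τ ∈ separation (LevySigma 1), Sentence.Realize K τ)
    (hcoll : ∀ τ ∈ collection Delta0, Sentence.Realize K τ) {δ : LSet.Formula (Fin 2)}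
    (hδ : Delta0 (Fin 2) 0 δ) (u : K) :
    ∃ v, ∀ p, Mem p u → (∃ Y, δ.Realize ![p, Y]) → ∃ Y, Mem Y v ∧ δ.Realize ![p, Y] := by
  rw [realize_separation] at hsep
  rw [realize_collection] at hcoll
  obtain ⟨ψ, hψ, eψ⟩ := hδ.reindex (m := 1)
    (Sum.elim ![Sum.inl (Sum.inr 0), Sum.inr 0] Fin.elim0 :
      Fin 2 ⊕ Fin 0 → (Fin 0 ⊕ Fin 1) ⊕ Fin 1)
  obtain ⟨χ, hχ, eχ⟩ := hδ.reindex (m := 0)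
    (Sum.elim ![Sum.inl (Sum.inr 0), Sum.inl (Sum.inr 1)] Fin.elim0 :
      Fin 2 ⊕ Fin 0 → (Fin 0 ⊕ Fin 2) ⊕ Fin 0)
  have hcl : LevySigma 1 _ _ (∃' ψ) := by
    simp only [LevySigma, SigmaOver, PiOver]
    exact .ex (.base hψ)
  obtain ⟨A, hA⟩ := hsep 0 (∃' ψ) hcl default u
  have hψ' : ∀ p, (∃' ψ).Realize (Sum.elim (default : Fin 0 → K) fun _ => p) default ↔
      ∃ Y, δ.Realize ![p, Y] := by
    intro p
    rw [BoundedFormula.realize_ex]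
    refine exists_congr fun Y => ?_
    rw [eψ]
    refine iff_of_eq (congrArg₂ (BoundedFormula.Realize δ) ?_ (Subsingleton.elim _ _))
    funext i
    fin_cases i <;> rfl
  have hχ' : ∀ p Y, χ.Realize (Sum.elim (default : Fin 0 → K) ![p, Y]) default ↔
      δ.Realize ![p, Y] := by
    intro p Y
    rw [eχ]
    refine iff_of_eq (congrArg₂ (BoundedFormula.Realize δ) ?_ (Subsingleton.elim _ _))
    funext i
    fin_cases i <;> rfl
  obtain ⟨v, hv⟩ := hcoll 0 χ hχ default A fun p hp => by
    obtain ⟨Y, hY⟩ := (hψ' p).1 ((hA p).1 hp).2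
    exact ⟨Y, (hχ' p Y).2 hY⟩
  refine ⟨v, fun p hp h => ?_⟩
  obtain ⟨Y, hY, h'⟩ := hv p ((hA p).2 ⟨hp, (hψ' p).2 h⟩)
  exact ⟨Y, hY, (hχ' p Y).1 h'⟩

/-- `N` contains a witness for each true existential statement about one of its elements with a
bounded matrix. -/
def Reflecting (N : Set K) : Prop :=
  ∀ δ : LSet.Formula (Fin 2), Delta0 (Fin 2) 0 δ → ∀ p ∈ N,
    (∃ Y, δ.Realize ![p, Y]) → ∃ Y ∈ N, δ.Realize ![p, Y]

theorem exists_reflecting_tower (hK : BaseModel K)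
    (hsep : ∀ τ ∈ separation (LevySigma 1), Sentence.Realize K τ)
    (hcoll : ∀ τ ∈ collection Delta0, Sentence.Realize K τ) {k : ℕ} (a : Fin k → K) :
    ∃ V : ℕ → K, IsTower V ∧ (∀ i, a i ∈ limit V) ∧ Reflecting (limit V) := by
  obtain ⟨e, he⟩ := exists_surjective_nat (LSet.Formula (Fin 2))
  let R : ℕ → K → K → Prop := fun n u v => Delta0 (Fin 2) 0 (e n.unpair.1) → ∀ p, Mem p u →
    (∃ Y, (e n.unpair.1).Realize ![p, Y]) → ∃ Y, Mem Y v ∧ (e n.unpair.1).Realize ![p, Y]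
  obtain ⟨V, hV, haV, hR⟩ := hK.exists_tower R (fun n u => by
    by_cases hδ : Delta0 (Fin 2) 0 (e n.unpair.1)
    · obtain ⟨v, hv⟩ := exists_reflecting hsep hcoll hδ u
      exact ⟨v, fun w hw _ p hp h => let ⟨Y, hY, h'⟩ := hv p hp h; ⟨Y, hw Y hY, h'⟩⟩
    · exact ⟨u, fun w _ h => absurd h hδ⟩) a
  refine ⟨V, hV, haV, fun δ hδ p ⟨m, hm⟩ h => ?_⟩
  obtain ⟨i, rfl⟩ := he δ
  -- Stage `Nat.pair i m` treats the formula numbered `i` and is not earlier than stage `m`, so its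
  -- set contains `p`.
  have := hR (Nat.pair i m)
  simp only [R, Nat.unpair_pair] at this
  obtain ⟨Y, hY, h'⟩ := this hδ p (hV.mono (Nat.right_le_pair i m) p hm) h
  exact ⟨Y, ⟨_, hY⟩, h'⟩

variable {V : ℕ → K}

/-- Induction on the number of parameters: the first two are merged into an ordered pair `p`. The
matrix stays bounded by asking for a set `Z` that contains the components of `p` together with the
witness. A `Z` in the limit has its elements there, and injectivity of pairing recovers the original
parameters. -/
theorem IsTower.exists_witness (hV : IsTower V) (hK : BaseModel K)
    (hR : Reflecting (limit V)) (k : ℕ) : ∀ δ : LSet.Formula (Fin (k + 2)),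
      Delta0 (Fin (k + 2)) 0 δ → ∀ z : Fin (k + 1) → limit V,
        (∃ Y : K, δ.Realize (Fin.cons Y fun i => (z i : K) : Fin (k + 2) → K)) →
          ∃ Y : limit V, δ.Realize (Fin.cons (Y : K) fun i => (z i : K) : Fin (k + 2) → K) := by
  induction k with
  | zero =>
    intro δ hδ z h
    obtain ⟨ψ, hψ, e⟩ := hδ.reindex (m := 0)
      (Sum.elim ![Sum.inl 1, Sum.inl 0] Fin.elim0 : Fin 2 ⊕ Fin 0 → Fin 2 ⊕ Fin 0)
    have hψ' : ∀ Y, BoundedFormula.Realize ψ ![(z 0 : K), Y] default ↔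
        δ.Realize (Fin.cons Y fun i => (z i : K) : Fin 2 → K) := by
      intro Y
      rw [e]
      refine iff_of_eq (congrArg₂ (BoundedFormula.Realize δ) ?_ (Subsingleton.elim _ _))
      funext i
      fin_cases i <;> rfl
    obtain ⟨Y, hY⟩ := h
    obtain ⟨Y, hYN, hY⟩ := hR ψ hψ (z 0) (z 0).2 ⟨Y, (hψ' Y).2 hY⟩
    exact ⟨⟨Y, hYN⟩, (hψ' Y).1 hY⟩
  | succ k ih =>
    intro δ hδ z h
    let r : Fin k → limit V := fun i => z i.succ.succ
    let f : Fin (k + 3) → Fin (k + 2) ⊕ Fin 3 :=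
      Fin.cons (Sum.inr 2) (Fin.cons (Sum.inr 0) (Fin.cons (Sum.inr 1)
        fun i : Fin k => Sum.inl i.succ.succ))
    obtain ⟨ψ, hψ, e⟩ := hδ.reindex (m := 3) (Sum.elim f Fin.elim0)
    let B : ∀ {m : ℕ}, LSet.Term (Fin (k + 2) ⊕ Fin m) := free 0
    let χ : LSet.Formula (Fin (k + 2)) :=
      bexMem B (bexMem B (bexMem B (opairD0 (free 1) (&0) (&1) ⊓ ψ)))
    have hχ : Delta0 (Fin (k + 2)) 0 χ :=
      .bexMem _ (.bexMem _ (.bexMem _ ((delta0_opairD0 _ _ _).and hψ)))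
    have eχ : ∀ Z p : K, χ.Realize (Fin.cons Z (Fin.cons p fun i => (r i : K)) : Fin (k + 2) → K) ↔
        ∃ a, Mem a Z ∧ ∃ b, Mem b Z ∧ ∃ Y, Mem Y Z ∧ IsOPair p a b ∧
          δ.Realize (Fin.cons Y (Fin.cons a (Fin.cons b fun i => (r i : K))) :
            Fin (k + 3) → K) := by
      intro Z p
      simp only [χ, Formula.Realize, realize_bexMem, BoundedFormula.realize_inf,
        realize_opairD0 hK]
      refine exists_congr fun a => and_congr Iff.rfl (exists_congr fun b => and_congr Iff.rfl
        (exists_congr fun Y => and_congr Iff.rfl (and_congr Iff.rfl ?_)))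
      rw [e]
      refine iff_of_eq (congrArg₂ (BoundedFormula.Realize δ) ?_ (Subsingleton.elim _ _))
      funext i
      refine Fin.cases rfl (fun i => Fin.cases rfl (fun i => Fin.cases rfl (fun i => rfl) i) i) i
    have hz : (fun i => (z i : K)) =
        (Fin.cons (z 0 : K) (Fin.cons (z 1 : K) fun i => (r i : K)) : Fin (k + 2) → K) := by
      funext i
      refine Fin.cases rfl (fun i => Fin.cases rfl (fun i => rfl) i) i
    rw [hz] at h ⊢
    obtain ⟨Y, hY⟩ := h
    obtain ⟨p, hp⟩ := hV.exists_opair hK (z 0) (z 1)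
    have hcons : (fun i => ((Fin.cons p r : Fin (k + 1) → limit V) i : K)) =
        (Fin.cons (p : K) fun i => (r i : K) : Fin (k + 1) → K) := by
      funext i
      refine Fin.cases rfl (fun i => rfl) i
    have := ih χ hχ (Fin.cons p r)
    rw [hcons] at this
    obtain ⟨Z₁, hY₁, -⟩ := hK.exists_insert Y Y
    obtain ⟨Z₂, hb, h₂⟩ := hK.exists_insert (z 1 : K) Z₁
    obtain ⟨Z₃, ha, h₃⟩ := hK.exists_insert (z 0 : K) Z₂
    obtain ⟨Z, hZ⟩ := this ⟨Z₃, (eχ _ _).2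
      ⟨z 0, ha, z 1, h₃ _ hb, Y, h₃ _ (h₂ _ hY₁), hp, hY⟩⟩
    obtain ⟨a, -, b, -, Y', hY', hp', hδ'⟩ := (eχ _ _).1 hZ
    obtain ⟨rfl, rfl⟩ := hp.inj hK hp'
    exact ⟨⟨Y', hV.isInitial.mem Z.2 hY'⟩, hδ'⟩

theorem IsTower.exists_boundedWitness (hV : IsTower V) (hK : BaseModel K)
    (hR : Reflecting (limit V)) {α : Type} [Finite α] {n : ℕ}
    {δ : LSet.BoundedFormula (α ⊕ Fin 1) n} (hδ : Delta0 (α ⊕ Fin 1) n δ) (v : α → limit V)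
    (xs : Fin n → limit V)
    (h : ∃ Y : K, δ.Realize (Sum.elim (fun i => (v i : K)) fun _ => Y) fun i => (xs i : K)) :
    ∃ Y : limit V, δ.Realize (Sum.elim (fun i => (v i : K)) fun _ => (Y : K))
      fun i => (xs i : K) := by
  obtain ⟨m, ⟨g⟩⟩ := Finite.exists_equiv_fin (α ⊕ Fin n)
  -- A dummy parameter: `exists_witness` needs at least one, and `m` may be `0`.
  let c : limit V := ⟨V 0, hV.of_sub (n := 0) fun _ => id⟩
  let z : Fin (m + 1) → limit V := Fin.cons c fun i => Sum.elim v xs (g.symm i)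
  let f : (α ⊕ Fin 1) ⊕ Fin n → Fin (m + 2) ⊕ Fin 0 :=
    Sum.elim (Sum.elim (fun a => Sum.inl (g (Sum.inl a)).succ.succ) fun _ => Sum.inl 0)
      fun i => Sum.inl (g (Sum.inr i)).succ.succ
  obtain ⟨ψ, hψ, e⟩ := hδ.reindex f
  have e' : ∀ Y : K, Formula.Realize ψ (Fin.cons Y fun i => (z i : K) : Fin (m + 2) → K) ↔
      δ.Realize (Sum.elim (fun i => (v i : K)) fun _ => (Y : K)) fun i => (xs i : K) := by
    intro Y
    refine (e K _ _).trans (iff_of_eq (congrArg₂ (BoundedFormula.Realize δ) ?_ ?_))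
    · funext i
      rcases i with i | i
      · simp [f, z]
      · simp [f]
    · funext i
      simp [f, z]
  obtain ⟨Y, hY⟩ := h
  obtain ⟨Y, hY⟩ := hV.exists_witness hK hR m ψ hψ z ⟨Y, (e' Y).2 hY⟩
  exact ⟨Y, (e' Y).1 hY⟩

/-- The downward direction is a Tarski–Vaught argument. Bounding the whole block by one set turns
the statement into the existence of a single witness for a bounded formula, which is reflected into
the limit; a value of the first quantifier is an element of that set, and the induction goes on with
the rest of the block. -/
theorem IsTower.sigmaOne_iff (hV : IsTower V) (hK : BaseModel K) (hR : Reflecting (limit V))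
    {α : Type} [Finite α] {n : ℕ} {φ : LSet.BoundedFormula α n} (hφ : ExBlock Delta0 α n φ)
    (v : α → limit V) (xs : Fin n → limit V) :
    φ.Realize v xs ↔ φ.Realize (fun a => (v a : K)) fun i => (xs i : K) := by
  have hN := hV.isInitial
  refine ⟨hφ.realize_of_realize_coe
    (fun m ψ hψ w ys => (hN.realize_iff hψ.delta0P w ys).1) v xs, fun h => ?_⟩
  induction hφ with
  | base hδ => exact (hN.realize_iff hδ.delta0P v xs).2 h
  | ex hφ ih =>
    obtain ⟨δ, hδ, e⟩ := hφ.exists_bounded hK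
    obtain ⟨a, ha⟩ := BoundedFormula.realize_ex.1 h
    obtain ⟨Y, hY⟩ := (e _ _).2 ha
    obtain ⟨Z, haZ, hYZ⟩ := hK.exists_insert a Y
    have hZ : ∃ Z : K, (bexMem (free (Sum.inr 0)) δ).Realize
        (Sum.elim (fun i => (v i : K)) fun _ => Z) fun i => (xs i : K) :=
      ⟨Z, (realize_bexMem _ _ _ _).2 ⟨a, haZ, hY Z hYZ⟩⟩
    obtain ⟨W, hW⟩ := hV.exists_boundedWitness hK hR (.bexMem _ hδ) v xs hZ
    obtain ⟨b, hb, hδb⟩ := (realize_bexMem _ _ _ _).1 hW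
    have hφb := (e _ _).1 _ hδb
    refine BoundedFormula.realize_ex.2 ⟨⟨b, hN.mem W.2 hb⟩, ih _ ?_⟩
    rw [coe_snoc]
    exact hφb

theorem AllBlock.exists_not {α : Type} {n : ℕ} {φ : LSet.BoundedFormula α n}
    (hφ : AllBlock Delta0 α n φ) : ∃ ψ, ExBlock Delta0 α n ψ ∧
      ∀ (K : Type) [LSet.Structure K] (v : α → K) (xs : Fin n → K),
        ψ.Realize v xs ↔ ¬φ.Realize v xs := by
  induction hφ with
  | base h => exact ⟨_, .base (.imp h .falsum), fun K _ v xs => BoundedFormula.realize_not⟩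
  | all _ ih =>
    obtain ⟨ψ, hψ, e⟩ := ih
    refine ⟨∃' ψ, .ex hψ, fun K _ v xs => ?_⟩
    simp only [BoundedFormula.realize_ex, e, BoundedFormula.realize_all, not_forall]

theorem IsTower.piOne_iff (hV : IsTower V) (hK : BaseModel K) (hR : Reflecting (limit V))
    {α : Type} [Finite α] {n : ℕ} {φ : LSet.BoundedFormula α n} (hφ : AllBlock Delta0 α n φ)
    (v : α → limit V) (xs : Fin n → limit V) :
    φ.Realize v xs ↔ φ.Realize (fun a => (v a : K)) fun i => (xs i : K) := by
  obtain ⟨ψ, hψ, e⟩ := hφ.exists_not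
  have := hV.sigmaOne_iff hK hR hψ v xs
  rw [e, e] at this
  exact not_iff_not.1 this

/-- `Σ₁`-elementarity of the limit makes `Π₁` formulas absolute. Hence `Σ₁`-separation descends from
`K`, while both collection schemes hold in the limit by saturation. -/
theorem conservative_MOST :
    ConservativeOver (LevyPi 3 Empty 0) (MOST ∪ collection (LevyPi 1)) MOST := by
  refine conservative_of_limit (D := LevyPi 1) Set.subset_union_left (fun σ h => ?_) ?_
  · simpa only [LevyPi, PiOver, SigmaOver] using h
  intro K _ hK hT k a
  have hM : ∀ τ ∈ M, Sentence.Realize K τ := fun τ hτ => hT τ (.inl (.inl (.inl hτ)))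
  have hB := ((realize_M K).1 hM).1
  have hsep : ∀ τ ∈ separation (LevySigma 1), Sentence.Realize K τ :=
    fun τ hτ => hT τ (.inl (.inr hτ))
  obtain ⟨V, hV, haV, hR⟩ := exists_reflecting_tower hB hsep (fun τ hτ => hT τ (.inr hτ)) a
  have hN := hV.isInitial
  have hdef : ∀ {α : Type} (v : α → limit V) (φ : LSet.Formula α),
      φ.Realize (fun a => (v a : K)) ↔
        BoundedFormula.Realize φ (fun a => (v a : K)) fun i => ((default : Fin 0 → limit V) i : K) :=
    fun v φ => iff_of_eq (congrArg (BoundedFormula.Realize φ _) (Subsingleton.elim _ _))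
  have hpi : ∀ {α : Type} [Finite α] {n : ℕ} {φ : LSet.BoundedFormula α n}, LevyPi 1 α n φ →
      ∀ (v : α → limit V) (xs : Fin n → limit V),
        φ.Realize v xs ↔ φ.Realize (fun a => (v a : K)) fun i => (xs i : K) := fun hφ v xs =>
    hV.piOne_iff hB hR (by simpa only [LevyPi, PiOver, SigmaOver] using hφ) v xs
  refine ⟨limit V, ⟨V 0, hV.of_sub (n := 0) fun _ => id⟩, haV, ?_,
    fun m ψ hψ v xs h => (hpi hψ v xs).1 h⟩
  rintro τ ((((hτ | hτ) | hτ) | hτ) | hτ)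
  · exact hV.realize_M hM τ hτ
  · rw [Set.mem_singleton_iff.1 hτ]
    exact hV.realize_choice hB (hT _ (.inl (.inl (.inr rfl))))
  · refine hN.realize_separation (fun k φ hφ v => ?_) hsep τ hτ
    rw [hdef]
    exact hV.sigmaOne_iff hB hR (by simpa only [LevySigma, PiOver, SigmaOver] using hφ) v _
  · exact hK.realize_collection hV (fun k φ hφ v => hN.formula_realize_iff hφ.delta0P v) τ hτ
  · refine hK.realize_collection hV (fun k φ hφ v => ?_) τ hτ
    rw [hdef]
    exact hpi hφ v _

end SigmaOne

end WeakSetTheory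

theorem mainTheorem3 :
    WeakSetTheory.ConservativeOver (WeakSetTheory.TakahashiPi 2 Empty 0)
        (WeakSetTheory.MH ∪ WeakSetTheory.collection WeakSetTheory.Delta0P)
        WeakSetTheory.MH ∧
      WeakSetTheory.ConservativeOver (WeakSetTheory.LevyPi 3 Empty 0)
        (WeakSetTheory.MOST ∪ WeakSetTheory.collection (WeakSetTheory.LevyPi 1))
        WeakSetTheory.MOST :=
  ⟨WeakSetTheory.conservative_MH, WeakSetTheory.conservative_MOST⟩
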